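/- **Setting.** Let $K$ be a field of characteristic $0$, $V=K^s$ with coordinates $x_1,\dots,x_s$, and $U=V^*$ with the dual coordinates $y_1,\dots,y_s$. Let $X=(a_1,\dots,a_N)$ be a list of non-zero vectors spanning $V$ (repetitions allowed). A vector $v\in V$ is viewed both as a linear function on $U$ and as the directional derivative $D_v$ on polynomials on $V$; for a sublist $Y\subset X$ put $D_Y=\prod_{a\in Y}D_a$. A sublist $Y$ is a *cocircuit* if $X\setminus Y$ does not span $V$; $D(X)$ is the space of polynomials $p$ on $V$ with $D_Yp=0$ for all cocircuits $Y$, and $D(X)_{k}$ is its part of degree $k$. A basis $b=(a_{i_1},\dots,a_{i_s})$, $i_1<\dots<i_s$, extracted from $X$ is *no broken* if the only $a_i$ for which there is an $e$ with $i\le i_e$ and $a_i\in\langle a_{i_e},\dots,a_{i_s}\rangle$ are the elements of $b$ itself. Let $\mathcal{NB}$ be the set of no broken bases, and for $b\in\mathcal{NB}$ put $D_b=\prod_{a\in X\setminus b}D_a$. **Proposition.** (1) There is a unique family $(p_b)_{b\in\mathcal{NB}}$ of homogeneous polynomials on $V$ of degree $N-s$ such that, as rational functions on $U$, $$\frac1{\prod_{a\in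 X}a}=\sum_{b\in\mathcal{NB}}p_b(\partial_{y_1},\dots,\partial_{y_s})\,\frac1{\prod_{a\in b}a}.$$ The $p_b$ lie in $D(X)_{N-s}$ and for all $b,c\in\mathcal{NB}$ $$D_b\big(p_c(-x)\big)=\delta_{b,c},\qquad\text{i.e. } D_bp_c=(-1)^{N-s}\delta_{b,c}.$$ The polynomials $p_b$, $b\in\mathcal{NB}$, are linearly independent, and they are characterized in $D(X)_{N-s}$ by these equations: if $q\in D(X)_{N-s}$ and $c\in\mathcal{NB}$ satisfy $D_b(q(-x))=\delta_{b,c}$ for all $b\in\mathcal{NB}$, then $q=p_c$. (2) Let $K=\mathbb R$ and assume that $0$ is not in the convex hull of $X$. For a sublist $Y$ let $C(Y)$ be the closed convex cone generated by $Y$; the *big cells* are the connected components of the set of regular points $C(X)\setminus\bigcup_{b\in\mathcal{NB}}\partial C(b)$. The multivariate spline $T_X$ is the locally integrable function on $V$ (determined almost everywhere) with $$\int_{\mathbb R^s}f(x)T_X(x)\,dx=\int_{\mathbb R_{\ge 0}^N}f\Big(\sum_{i=1}^Nt_ia_i\Big)dt$$ for all continuous $f$ with compact support. Such a function exists and can be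 chosen continuous on every big cell. For every big cell $\mathfrak c$ there is exactly one $T\in D(X)_{N-s}$ with $$D_bT=\begin{cases}|\det(b)|^{-1}&\text{if }\mathfrak c\subset C(b),\\0&\text{otherwise,}\end{cases}\qquad b\in\mathcal{NB},$$ and $T_X=T$ on $\mathfrak c$: almost everywhere for every choice of $T_X$, and everywhere on $\mathfrak c$ if the chosen $T_X$ is continuous on $\mathfrak c$. -/

import Mathlib

open MvPolynomial MeasureTheory

namespace Spline

section Algebra

variable {K : Type*} [Field K] {s N : ℕ}

/-! ### Polynomials, constant coefficient operators, rational functions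

`V = K^s` with coordinates `x_1, …, x_s`, and `U` is its dual, with the dual coordinates
`y_1, …, y_s`. Both `S[U]` (polynomial functions on `V`) and `S[V]` (polynomial functions on `U`)
are `MvPolynomial (Fin s) K`. -/

/-- The vector `v ∈ V` as an element of degree one of `S[V]`, i.e. as a linear function on `U`. -/
noncomputable def linForm (v : Fin s → K) : MvPolynomial (Fin s) K :=
  ∑ j, C (v j) * X j

/-- The product `∏_{i ∈ Y} a_i ∈ S[V]` of the vectors of a sublist `Y`. -/
noncomputable def listProd (a : Fin N → Fin s → K) (Y : Finset (Fin N)) :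
    MvPolynomial (Fin s) K :=
  ∏ i ∈ Y, linForm (a i)

/-- For (commuting) operators `∂ 0, …, ∂ (s-1)` on `M` and a polynomial `p`, the operator `p(∂)`,
obtained by substituting `∂ j` for the `j`-th variable. -/
noncomputable def polyOp {M : Type*} [AddCommGroup M] [Module K M]
    (D : Fin s → Module.End K M) (p : MvPolynomial (Fin s) K) : Module.End K M :=
  ∑ m ∈ p.support, coeff m p • (List.ofFn fun j => D j ^ m j).prod

/-- An element of `S[V]` acting on polynomial functions on `V` as a differential operator with
constant coefficients (a vector `v` acts as the directional derivative `D_v`). -/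
noncomputable def diffOp (q : MvPolynomial (Fin s) K) : Module.End K (MvPolynomial (Fin s) K) :=
  polyOp (fun j => (pderiv j).toLinearMap) q

/-- The operator `D_Y = ∏_{i ∈ Y} D_{a_i}` on polynomial functions on `V`. -/
noncomputable def DOp (a : Fin N → Fin s → K) (Y : Finset (Fin N)) :
    Module.End K (MvPolynomial (Fin s) K) :=
  diffOp (listProd a Y)

/-- The polynomial `p(-x)`. -/
noncomputable def reflect (p : MvPolynomial (Fin s) K) : MvPolynomial (Fin s) K :=
  aeval (fun j => -X j) p

/-- The field of rational functions on `U`. -/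
abbrev RatU (K : Type*) [Field K] (s : ℕ) : Type _ := FractionRing (MvPolynomial (Fin s) K)

/-- `f ↦ f + ε ∂f/∂y_j`, from polynomials to dual numbers over rational functions. -/
noncomputable def jetHom (j : Fin s) :
    MvPolynomial (Fin s) K →ₐ[K] DualNumber (RatU K s) where
  toFun f := TrivSqZeroExt.inl (algebraMap _ (RatU K s) f) +
    TrivSqZeroExt.inr (algebraMap _ (RatU K s) (pderiv j f))
  map_one' := by ext <;> simp
  map_zero' := by ext <;> simp
  map_add' f g := by ext <;> simp [Algebra.smul_def]
  map_mul' f g := by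
    ext
    · simp
    · simp [Derivation.leibniz, Algebra.smul_def, TrivSqZeroExt.algebraMap_eq_inl]
      ring
  commutes' r := by
    ext
    · simp [TrivSqZeroExt.algebraMap_eq_inl', MvPolynomial.algebraMap_eq,
        IsScalarTower.algebraMap_apply K (MvPolynomial (Fin s) K) (RatU K s)]
    · simp [TrivSqZeroExt.algebraMap_eq_inl', MvPolynomial.algebraMap_eq]

theorem jetHom_isUnit (j : Fin s) (g : nonZeroDivisors (MvPolynomial (Fin s) K)) :
    IsUnit (jetHom (K := K) j g) := by
  rw [TrivSqZeroExt.isUnit_iff_isUnit_fst]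
  simp [jetHom]

/-- `r ↦ r + ε ∂r/∂y_j` on rational functions. -/
noncomputable def jetHomRat (j : Fin s) : RatU K s →ₐ[K] DualNumber (RatU K s) :=
  IsLocalization.liftAlgHom (M := nonZeroDivisors (MvPolynomial (Fin s) K)) (f := jetHom j)
    (jetHom_isUnit j)

theorem jetHomRat_algebraMap (j : Fin s) (f : MvPolynomial (Fin s) K) :
    jetHomRat j (algebraMap _ (RatU K s) f) = jetHom j f := by
  simp [jetHomRat]

theorem jetHomRat_fst (j : Fin s) (r : RatU K s) : (jetHomRat j r).fst = r := by
  have h : ((TrivSqZeroExt.fstHom K (RatU K s) (RatU K s)).comp (jetHomRat j)) =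
      AlgHom.id K (RatU K s) := by
    apply IsLocalization.algHom_ext (nonZeroDivisors (MvPolynomial (Fin s) K))
    ext f
    change (jetHomRat j (algebraMap _ (RatU K s) (X f))).fst = algebraMap _ (RatU K s) (X f)
    rw [jetHomRat_algebraMap]
    simp [jetHom]
  exact DFunLike.congr_fun h r

/-- The partial derivative `∂/∂y_j` on rational functions: the unique derivation that extends the
partial derivative of polynomials. -/
noncomputable def ratPartial (j : Fin s) : Derivation K (RatU K s) (RatU K s) :=
  Derivation.mk'
    ((TrivSqZeroExt.sndHom (RatU K s) (RatU K s)).restrictScalars K ∘ₗ (jetHomRat j).toLinearMap)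
    (by
      intro f g
      simp [jetHomRat_fst, mul_comm])

theorem ratPartial_algebraMap (j : Fin s) (f : MvPolynomial (Fin s) K) :
    ratPartial j (algebraMap _ (RatU K s) f) = algebraMap _ (RatU K s) (pderiv j f) := by
  simp [ratPartial, jetHomRat_algebraMap, jetHom, Algebra.smul_def,
    TrivSqZeroExt.algebraMap_eq_inl]

/-- `p(∂_y)` acting on rational functions on `U`, for a polynomial function `p` on `V`. -/
noncomputable def ratDiffOp (p : MvPolynomial (Fin s) K) : Module.End K (RatU K s) :=
  polyOp (fun j => (ratPartial j).toLinearMap) p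

/-- The rational function `1 / ∏_{i ∈ Y} a_i` on `U`. -/
noncomputable def invProd (a : Fin N → Fin s → K) (Y : Finset (Fin N)) : RatU K s :=
  (algebraMap _ (RatU K s) (listProd a Y))⁻¹

/-! ### Cocircuits, the space `D(X)` and no broken bases -/

/-- A sublist is a cocircuit if the remaining vectors do not span `V`. -/
def IsCocircuit (a : Fin N → Fin s → K) (Y : Finset (Fin N)) : Prop :=
  Submodule.span K (a '' {i | i ∉ Y}) ≠ ⊤

/-- `D(X)`: the polynomials killed by `D_Y` for all cocircuits `Y`. -/
noncomputable def DX (a : Fin N → Fin s → K) : Submodule K (MvPolynomial (Fin s) K) :=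
  ⨅ (Y : Finset (Fin N)) (_ : IsCocircuit a Y), LinearMap.ker (DOp a Y)

/-- `D(X)_k`: the homogeneous elements of degree `k` of `D(X)`. -/
noncomputable def DXdeg (a : Fin N → Fin s → K) (k : ℕ) :
    Submodule K (MvPolynomial (Fin s) K) :=
  DX a ⊓ homogeneousSubmodule (Fin s) K k

/-- A sublist (given by its set of indices) that is a basis of `V`. -/
def IsBasisSub (a : Fin N → Fin s → K) (b : Finset (Fin N)) : Prop :=
  LinearIndepOn K a (b : Set (Fin N)) ∧ Submodule.span K (a '' (b : Set (Fin N))) = ⊤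

theorem IsBasisSub.card_eq {a : Fin N → Fin s → K} {b : Finset (Fin N)} (h : IsBasisSub a b) :
    b.card = s := by
  have h1 : LinearIndependent K (fun i : (b : Set (Fin N)) => a i) := h.1
  have h2 : Submodule.span K (Set.range fun i : (b : Set (Fin N)) => a i) = ⊤ := by
    rw [← h.2, Set.image_eq_range]
  have := Module.finrank_eq_card_basis (Module.Basis.mk h1 h2.ge)
  simpa using this.symm

/-- `a_i` breaks `b = (a_{i_1}, …, a_{i_k})`, `i_1 < … < i_k`, if for some `e` one has `i ≤ i_e`
and `a_i` is linearly dependent on `a_{i_e}, …, a_{i_k}`. -/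
def Breaks (a : Fin N → Fin s → K) (i : Fin N) (b : Finset (Fin N)) : Prop :=
  ∃ j ∈ b, i ≤ j ∧ a i ∈ Submodule.span K (a '' {l | l ∈ b ∧ j ≤ l})

/-- A basis extracted from the list is no broken if it is broken only by its own elements. -/
def IsNoBroken (a : Fin N → Fin s → K) (b : Finset (Fin N)) : Prop :=
  IsBasisSub a b ∧ ∀ i, Breaks a i b ↔ i ∈ b

/-- The type of no broken bases. -/
abbrev NB (a : Fin N → Fin s → K) : Type := {b : Finset (Fin N) // IsNoBroken a b}

noncomputable instance (a : Fin N → Fin s → K) : Fintype (NB a) := Fintype.ofFinite _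

/-- The defining property of the family `p_b`, `b` no broken: `p_b` is homogeneous of degree
`N - s`, and `1/∏_{a ∈ X} a = ∑_b p_b(∂_y) (1/∏_{a ∈ b} a)` as rational functions on `U`. -/
def IsPolarFamily (a : Fin N → Fin s → K) (p : NB a → MvPolynomial (Fin s) K) : Prop :=
  (∀ b, (p b).IsHomogeneous (N - s)) ∧
    invProd a Finset.univ = ∑ b : NB a, ratDiffOp (p b) (invProd a b.1)

end Algebra

/-! ### The multivariate spline and the big cells -/

section Real

variable {s N : ℕ}

/-- `T` is the multivariate spline of the list `a`: a locally integrable function with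
`∫_V f T = ∫_{t ≥ 0} f (∑ t_i a_i) dt` for all continuous `f` with compact support. -/
def IsMultivariateSpline (a : Fin N → Fin s → ℝ) (T : (Fin s → ℝ) → ℝ) : Prop :=
  LocallyIntegrable T volume ∧
    ∀ f : (Fin s → ℝ) → ℝ, Continuous f → HasCompactSupport f →
      ∫ x, f x * T x = ∫ t in {t : Fin N → ℝ | ∀ i, 0 ≤ t i}, f (∑ i, t i • a i)

/-- The closed convex cone generated by a sublist. -/
def cone (a : Fin N → Fin s → ℝ) (Y : Finset (Fin N)) : Set (Fin s → ℝ) :=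
  {x | ∃ t : Fin N → ℝ, (∀ i, 0 ≤ t i) ∧ x = ∑ i ∈ Y, t i • a i}

/-- The regular points: the points of `C(X)` outside the boundaries of the cones `C(b)`,
`b` no broken. -/
def regularPoints (a : Fin N → Fin s → ℝ) : Set (Fin s → ℝ) :=
  cone a Finset.univ \ ⋃ b : NB a, frontier (cone a b.1)

/-- The big cells: the connected components of the set of regular points. -/
def IsBigCell (a : Fin N → Fin s → ℝ) (c : Set (Fin s → ℝ)) : Prop :=
  ∃ x ∈ regularPoints a, c = connectedComponentIn (regularPoints a) x

/-- `|det(b)|`, the absolute value of the determinant of the vectors of a no broken basis. -/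
noncomputable def absDet (a : Fin N → Fin s → ℝ) (b : NB a) : ℝ :=
  |(Matrix.of fun k : Fin s => a (b.1.orderEmbOfFin b.2.1.card_eq k)).det|

/-- The system `D_b q = |det(b)|⁻¹` if `c ⊆ C(b)`, `D_b q = 0` otherwise (`b` no broken). -/
def SolvesCellSystem (a : Fin N → Fin s → ℝ) (c : Set (Fin s → ℝ))
    (q : MvPolynomial (Fin s) ℝ) : Prop :=
  ∀ b : NB a, (c ⊆ cone a b.1 → DOp a (b.1)ᶜ q = C (absDet a b)⁻¹) ∧
    (¬ c ⊆ cone a b.1 → DOp a (b.1)ᶜ q = 0)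

end Real

end Spline

/-! Part (1) takes place in the rational functions, as a module over polynomial differential
operators, modulo the submodule `lowerPoles` of sums of fractions whose denominators are products of
vectors in a proper subspace. For a basis b every coordinate y_j sends 1/∏_{a∈b} a into
`lowerPoles`. Hence, modulo this submodule, multiplying p(∂)(1/∏_{a∈b} a) by g only replaces p by
g(-∂)p (`mul_ratDiffHom_sub_mem`). Iterated residues form a dual system to the classes of the no
broken bases (`residue_lowerPoles`, `residue_invProd_self`, `residue_invProd_of_ne`), so these
classes are independent, even with homogeneous operators of a common degree as coefficients
(`eq_zero_of_sum_ratDiffHom_mem`).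

This gives the uniqueness of the p_b. Multiplying the defining identity by ∏_{a∈Y} a gives their
equations: a cocircuit Y leaves a fraction in `lowerPoles`, whence D_Y p_b = 0, and Y = X∖b leaves
1/∏_{a∈b} a, whence duality. Existence is a rewriting of fractions by linear relations that moves
denominators towards smaller indices (`invPow_mem_polarSpan`). The same exchange shows that the
equations for the no broken bases determine an element of D(X)_{N-s} (`eq_zero_of_mem_DXdeg`).

For part (2), choose y positive on X. On smooth functions that vanish where y is large, -D_v is
invertible for v in X, with integration along the rays of direction v as inverse. Thus 1/∏_{a∈X} a
acts, and its value at 0 is the integral over the orthant, while p(∂) applied to a fraction becomes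
multiplication of the test function by p(-x). The identity of part (1) therefore becomes T_X = ∑_b
|det b|⁻¹ p_b(-x) 1_{C(b)} (`integral_orthant_eq_sum`, `isMultivariateSpline_piecewiseSpline`). Each
cone C(b) contains or misses a given big cell, so on the cell this sum is one polynomial of
D(X)_{N-s}, and duality gives its values under the D_b. -/

namespace Spline

/-! ### Polynomials in commuting operators. -/

section PolyOp

open scoped IsMulCommutative

variable {K : Type*} [Field K] {s N : ℕ} {M : Type*} [AddCommGroup M] [Module K M]

theorem adjoin_range_comm (D : Fin s → Module.End K M) (hD : ∀ i j, D i * D j = D j * D i) :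
    IsMulCommutative (Algebra.adjoin K (Set.range D)) :=
  Algebra.isMulCommutative_adjoin K (by
    rintro _ ⟨i, rfl⟩ _ ⟨j, rfl⟩
    exact hD i j)

/-- Substitution of commuting operators, as an algebra homomorphism. -/
noncomputable def polyOpHom (D : Fin s → Module.End K M) (hD : ∀ i j, D i * D j = D j * D i) :
    MvPolynomial (Fin s) K →ₐ[K] Module.End K M :=
  haveI : IsMulCommutative (Algebra.adjoin K (Set.range D)) := adjoin_range_comm D hD
  (Algebra.adjoin K (Set.range D)).val.comp
    (aeval fun j => (⟨D j, Algebra.subset_adjoin ⟨j, rfl⟩⟩ : Algebra.adjoin K (Set.range D)))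

theorem polyOpHom_apply (D : Fin s → Module.End K M) (hD : ∀ i j, D i * D j = D j * D i)
    (p : MvPolynomial (Fin s) K) : polyOpHom D hD p = polyOp D p := by
  have : IsMulCommutative (Algebra.adjoin K (Set.range D)) := adjoin_range_comm D hD
  conv_lhs => rw [p.as_sum]
  rw [map_sum, polyOp]
  refine Finset.sum_congr rfl fun m _ => ?_
  rw [show monomial m (coeff m p) = coeff m p • monomial m (1 : K) by
    rw [smul_monomial, smul_eq_mul, mul_one], map_smul]
  congr 1
  change (Algebra.adjoin K (Set.range D)).val (aeval _ (monomial m (1 : K))) = _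
  rw [aeval_monomial, map_one, one_mul, Finsupp.prod_fintype _ _ (fun _ => pow_zero _),
    ← List.prod_ofFn, map_list_prod, List.map_ofFn]
  rfl

theorem polyOpHom_X (D : Fin s → Module.End K M) (hD : ∀ i j, D i * D j = D j * D i)
    (j : Fin s) : polyOpHom D hD (X j) = D j := by
  simp [polyOpHom]

end PolyOp

/-! ### Constant coefficient operators on polynomials and on rational functions. -/

section Algebra

variable {K : Type*} [Field K] {s N : ℕ}

/-- Applying D to r * Q = P leaves Q * D r = 0. -/
theorem derivation_eq_zero {D : Derivation K (RatU K s) (RatU K s)}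
    (h : ∀ f : MvPolynomial (Fin s) K, D (algebraMap _ _ f) = 0) : D = 0 := by
  ext r
  obtain ⟨P, Q, rfl⟩ := IsLocalization.exists_mk'_eq (nonZeroDivisors (MvPolynomial (Fin s) K)) r
  have h1 := IsLocalization.mk'_spec (RatU K s) P Q
  have h2 := congrArg D h1
  rw [Derivation.leibniz, h, h, smul_zero, zero_add, smul_eq_mul] at h2
  have h3 : algebraMap _ (RatU K s) (Q : MvPolynomial (Fin s) K) ≠ 0 := by simp
  exact (mul_eq_zero.1 h2).resolve_left h3

/-- The commutator of two derivations is a derivation, so it suffices that it vanishes on the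
variables. -/
theorem pderiv_pderiv_comm (i j : Fin s) (p : MvPolynomial (Fin s) K) :
    pderiv i (pderiv j p) = pderiv j (pderiv i p) := by
  let D (l : Fin s) : Derivation K (MvPolynomial (Fin s) K) (MvPolynomial (Fin s) K) := pderiv l
  have h : ⁅D i, D j⁆ = 0 := by
    refine derivation_ext fun k => ?_
    simp only [D, Derivation.commutator_apply, pderiv_X]
    simp only [Pi.single_apply]
    split_ifs <;> simp
  have := congrArg (fun D : Derivation K _ (MvPolynomial (Fin s) K) => D p) h
  simp only [D, Derivation.commutator_apply] at this
  exact sub_eq_zero.1 this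

theorem ratPartial_comm (i j : Fin s) :
    ((ratPartial (K := K) i).toLinearMap : Module.End K (RatU K s)) *
      (ratPartial (K := K) j).toLinearMap =
        (ratPartial (K := K) j).toLinearMap * (ratPartial (K := K) i).toLinearMap := by
  let D (l : Fin s) : Derivation K (RatU K s) (RatU K s) := ratPartial l
  have h : ⁅D i, D j⁆ = 0 := by
    refine derivation_eq_zero fun f => ?_
    simp only [D, Derivation.commutator_apply, ratPartial_algebraMap]
    rw [pderiv_pderiv_comm, sub_self]
  ext r
  have := congrArg (fun D : Derivation K (RatU K s) (RatU K s) => D r) h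
  simp only [D, Derivation.commutator_apply] at this
  exact sub_eq_zero.1 this

theorem pderiv_comm (i j : Fin s) :
    ((pderiv i).toLinearMap : Module.End K (MvPolynomial (Fin s) K)) * (pderiv j).toLinearMap =
      (pderiv j).toLinearMap * (pderiv i).toLinearMap :=
  LinearMap.ext fun p => pderiv_pderiv_comm i j p

/-- `diffOp` as an algebra homomorphism. -/
noncomputable def diffHom :
    MvPolynomial (Fin s) K →ₐ[K] Module.End K (MvPolynomial (Fin s) K) :=
  polyOpHom (fun j => (pderiv j).toLinearMap) pderiv_comm

/-- `ratDiffOp` as an algebra homomorphism. -/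
noncomputable def ratDiffHom : MvPolynomial (Fin s) K →ₐ[K] Module.End K (RatU K s) :=
  polyOpHom (fun j => (ratPartial j).toLinearMap) ratPartial_comm

theorem diffOp_eq (q : MvPolynomial (Fin s) K) : diffOp q = diffHom q :=
  (polyOpHom_apply _ _ _).symm

theorem ratDiffOp_eq (q : MvPolynomial (Fin s) K) : ratDiffOp q = ratDiffHom q :=
  (polyOpHom_apply _ _ _).symm

@[simp] theorem diffHom_X (j : Fin s) (p : MvPolynomial (Fin s) K) :
    diffHom (X j) p = pderiv j p := by
  rw [diffHom, polyOpHom_X]; rfl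

@[simp] theorem ratDiffHom_X (j : Fin s) (r : RatU K s) :
    ratDiffHom (X j) r = ratPartial j r := by
  rw [ratDiffHom, polyOpHom_X]; rfl

@[simp] theorem diffHom_C (c : K) (p : MvPolynomial (Fin s) K) : diffHom (C c) p = c • p := by
  rw [← algebraMap_eq, AlgHom.commutes]; rfl

@[simp] theorem ratDiffHom_C (c : K) (r : RatU K s) : ratDiffHom (C c) r = c • r := by
  rw [← algebraMap_eq, AlgHom.commutes]; rfl

theorem linForm_isHomogeneous (v : Fin s → K) : (linForm v).IsHomogeneous 1 :=
  IsHomogeneous.sum _ _ _ fun j _ => by simpa using (isHomogeneous_C _ (v j)).mul (isHomogeneous_X K j)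

theorem listProd_isHomogeneous (a : Fin N → Fin s → K) (Y : Finset (Fin N)) :
    (listProd a Y).IsHomogeneous Y.card := by
  simpa [listProd] using IsHomogeneous.prod Y (fun i => linForm (a i)) (fun _ => 1)
    fun i _ => linForm_isHomogeneous _

/-- `linForm` as a linear map. -/
noncomputable def linFormL : (Fin s → K) →ₗ[K] MvPolynomial (Fin s) K where
  toFun := linForm
  map_add' u v := by simp [linForm, add_mul, Finset.sum_add_distrib]
  map_smul' c v := by simp [linForm, Finset.smul_sum, MvPolynomial.smul_eq_C_mul, mul_assoc]

@[simp] theorem linFormL_apply (v : Fin s → K) : linFormL v = linForm v := rfl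

theorem pderiv_linForm (j : Fin s) (v : Fin s → K) : pderiv j (linForm v) = C (v j) := by
  simp [linForm, Derivation.leibniz, pderiv_X, Pi.single_apply]

theorem linForm_ne_zero {v : Fin s → K} (hv : v ≠ 0) : linForm v ≠ 0 := by
  intro h
  apply hv
  ext j
  simpa [h] using (pderiv_linForm j v).symm

theorem linForm_single (j : Fin s) : linForm (Pi.single j (1 : K)) = X j := by
  rw [linForm, Finset.sum_eq_single j] <;> simp +contextual

theorem diffHom_isHomogeneous {q p : MvPolynomial (Fin s) K} {k n : ℕ}
    (hq : q.IsHomogeneous k) (hp : p.IsHomogeneous (n + k)) :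
    (diffHom q p).IsHomogeneous n := by
  rw [q.as_sum, map_sum, LinearMap.sum_apply]
  refine IsHomogeneous.sum _ _ _ fun m hm => ?_
  have hk : m.degree = k := by
    have := hq (mem_support_iff.1 hm)
    rwa [Finsupp.degree_eq_weight_one]
  rw [← mul_one (coeff m q), ← smul_eq_mul, ← smul_monomial, map_smul, LinearMap.smul_apply]
  refine Submodule.smul_mem (homogeneousSubmodule (Fin s) K n) _ ?_
  clear hm hq
  induction m using Finsupp.induction_linear generalizing k n p with
  | zero =>
    simp only [map_zero] at hk
    subst hk
    simpa using hp
  | add f g hf hg =>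
    rw [show monomial (f + g) (1 : K) = monomial f 1 * monomial g 1 by simp [monomial_mul],
      map_mul]
    rw [map_add] at hk
    refine hf (k := f.degree) (hg (k := g.degree) ?_ rfl) rfl
    rwa [add_assoc, hk]
  | single j e =>
    simp only [Finsupp.degree_single] at hk
    subst hk
    rw [show monomial (Finsupp.single j e) (1 : K) = X j ^ e by rw [X_pow_eq_monomial], map_pow]
    induction e generalizing n with
    | zero => simpa using hp
    | succ e ih =>
      rw [pow_succ', Module.End.mul_apply, diffHom_X]
      have := ih (n := n + 1) (by rwa [add_assoc, add_comm 1])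
      simpa using this.pderiv (i := j)

/-- Euler's identity gives (n + 1) p = ∑ x_j ∂_j p, and n + 1 is invertible in characteristic 0. -/
theorem eq_zero_of_pderiv_eq_zero [CharZero K] {p : MvPolynomial (Fin s) K} {n : ℕ}
    (hp : p.IsHomogeneous (n + 1)) (h : ∀ j, pderiv j p = 0) : p = 0 := by
  have h1 := hp.sum_X_mul_pderiv
  simp only [h, mul_zero, Finset.sum_const_zero] at h1
  exact (smul_eq_zero.1 h1.symm).resolve_left (by simp)

theorem eq_C_of_isHomogeneous {p : MvPolynomial (Fin s) K} (hp : p.IsHomogeneous 0) :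
    p = C (coeff 0 p) :=
  totalDegree_eq_zero_iff_eq_C.1 (Nat.le_zero.1 hp.totalDegree_le)

theorem pderiv_sum_linForm (v : Fin s → K) (p : MvPolynomial (Fin s) K) :
    diffHom (linForm v) p = ∑ j, v j • pderiv j p := by
  simp [linForm, map_sum]

theorem listProd_union (a : Fin N → Fin s → K) {Y Z : Finset (Fin N)} (h : Disjoint Y Z) :
    listProd a (Y ∪ Z) = listProd a Y * listProd a Z := Finset.prod_union h

theorem listProd_insert (a : Fin N → Fin s → K) {i : Fin N} {Y : Finset (Fin N)} (h : i ∉ Y) :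
    listProd a (insert i Y) = linForm (a i) * listProd a Y := Finset.prod_insert h

/-- Already n of the factors turn p into a constant, which the next directional derivative kills. -/
theorem diffHom_listProd_eq_zero (a : Fin N → Fin s → K) {Y : Finset (Fin N)} {n : ℕ}
    {p : MvPolynomial (Fin s) K} (hp : p.IsHomogeneous n) (h : n < Y.card) :
    diffHom (listProd a Y) p = 0 := by
  obtain ⟨Z, hZ, hZn⟩ := Finset.exists_subset_card_eq h.le
  obtain ⟨i, hi⟩ : (Y \ Z).Nonempty := by
    rw [← Finset.card_pos, Finset.card_sdiff_of_subset hZ]; omega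
  have h1 : (diffHom (listProd a Z) p).IsHomogeneous 0 :=
    diffHom_isHomogeneous (listProd_isHomogeneous a Z) (by rwa [hZn, zero_add])
  rw [← Finset.sdiff_union_of_subset hZ, listProd_union a Finset.sdiff_disjoint,
    ← Finset.insert_erase hi, listProd_insert a (Finset.notMem_erase _ _), map_mul,
    mul_comm (linForm _), map_mul, Module.End.mul_apply, Module.End.mul_apply, eq_C_of_isHomogeneous h1,
    pderiv_sum_linForm]
  simp

end Algebra

/-! ### Iterated Laurent series and the residue attached to an ordered basis. -/

section Residue

variable {K : Type*} [Field K] {s N : ℕ} {ι : Type*}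

theorem ofLex_sum_apply {κ : Type*} (c : Finset κ) (f : κ → Lex (ιᵒᵈ → ℤ)) (k : ιᵒᵈ) :
    ofLex (∑ j ∈ c, f j) k = ∑ j ∈ c, ofLex (f j) k := by
  induction c using Finset.cons_induction with
  | empty => rfl
  | cons j c hj ih => rw [Finset.sum_cons, Finset.sum_cons, ← ih]; rfl

variable [LinearOrder ι]

/-- Iterated Laurent series in variables `z_i`, `i ∈ ι`, where `z_i` is infinitesimal with respect
to `z_j` for `j < i`. -/
abbrev LexSeries (K : Type*) [Field K] (ι : Type*) [LinearOrder ι] [Fintype ι] : Type _ :=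
  HahnSeries (Lex (ιᵒᵈ → ℤ)) K

/-- The exponent of `z_i`. -/
def expo (i : ι) : Lex (ιᵒᵈ → ℤ) := toLex (Pi.single (OrderDual.toDual i) 1)

/-- The reversed index order makes the largest index the most significant one. So z_i / z_j is
infinitesimal for j < i, and a linear form is dominated by its coordinate of smallest index. -/
theorem expo_lt {i j : ι} (h : j < i) : expo j < expo i := by
  refine ⟨OrderDual.toDual i, fun k hk => ?_, ?_⟩
  · have h1 : i < OrderDual.ofDual k := hk
    have h2 : k ≠ OrderDual.toDual i := fun e => by subst e; exact lt_irrefl _ h1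
    have h3 : k ≠ OrderDual.toDual j := fun e => by subst e; exact lt_irrefl _ (h1.trans h)
    simp [expo, h2, h3]
  · have h2 : OrderDual.toDual i ≠ OrderDual.toDual j := fun e => h.ne' (OrderDual.toDual.injective e)
    simp [expo, h2]

variable [Fintype ι]

/-- The series whose exponents lie in a given additive submonoid. -/
def suppSubalgebra (K : Type*) [Field K] (S : AddSubmonoid (Lex (ιᵒᵈ → ℤ))) :
    Subalgebra K (LexSeries K ι) where
  carrier := {x | x.support ⊆ S}
  mul_mem' {x y} hx hy := by
    refine HahnSeries.support_mul_subset.trans ?_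
    rintro _ ⟨g, hg, h, hh, rfl⟩
    exact S.add_mem (hx hg) (hy hh)
  add_mem' {x y} hx hy := (HahnSeries.support_add_subset x y).trans (Set.union_subset hx hy)
  algebraMap_mem' r := by
    rw [HahnSeries.algebraMap_apply, HahnSeries.C_apply]
    exact HahnSeries.support_single_subset.trans (by simp)

theorem mem_suppSubalgebra {S : AddSubmonoid (Lex (ιᵒᵈ → ℤ))} {x : LexSeries K ι} :
    x ∈ suppSubalgebra K S ↔ x.support ⊆ S := Iff.rfl

theorem single_mem_suppSubalgebra {S : AddSubmonoid (Lex (ιᵒᵈ → ℤ))} {g : Lex (ιᵒᵈ → ℤ)}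
    (hg : g ∈ S) (r : K) : (HahnSeries.single g r : LexSeries K ι) ∈ suppSubalgebra K S :=
  HahnSeries.support_single_subset.trans (by simpa using hg)

/-- The inverse is the geometric series in x, and every power of x has its support in S. -/
theorem inv_one_sub_mem_suppSubalgebra {S : AddSubmonoid (Lex (ιᵒᵈ → ℤ))} {x : LexSeries K ι}
    (hx : x ∈ suppSubalgebra K S) (h0 : 0 < x.orderTop) :
    (1 - x)⁻¹ ∈ suppSubalgebra K S := by
  rw [inv_eq_of_mul_eq_one_right (HahnSeries.SummableFamily.one_sub_self_mul_hsum_powers h0),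
    mem_suppSubalgebra]
  refine HahnSeries.SummableFamily.support_hsum_subset.trans (Set.iUnion_subset fun n => ?_)
  rw [HahnSeries.SummableFamily.powers_of_orderTop_pos h0]
  exact pow_mem hx n

theorem orderTop_pos {x : LexSeries K ι} (hx : ∀ g ∈ x.support, 0 < g) : 0 < x.orderTop := by
  by_cases h : x = 0
  · simp [h]
  · have h1 := HahnSeries.order_eq_orderTop_of_ne_zero h
    rw [← h1]
    have : x.order ∈ x.support := HahnSeries.coeff_orderTop_ne h1.symm
    exact_mod_cast hx _ this

variable (B : Module.Basis ι K (Fin s → K))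

/-- Expansion of polynomials in the coordinates given by a basis of `V`. -/
noncomputable def expand : MvPolynomial (Fin s) K →ₐ[K] LexSeries K ι :=
  aeval fun j => ∑ i, B.repr (Pi.single j 1) i • HahnSeries.single (expo i) (1 : K)

theorem expand_linForm (v : Fin s → K) :
    expand B (linForm v) = ∑ i, B.repr v i • HahnSeries.single (expo i) (1 : K) := by
  have h : v = ∑ j, v j • (Pi.single j (1 : K) : Fin s → K) := by
    conv_lhs => rw [← Finset.univ_sum_single v]
    exact Finset.sum_congr rfl fun j _ => by rw [← Pi.single_smul, smul_eq_mul, mul_one]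
  conv_rhs => rw [h]
  simp only [linForm, map_sum, map_mul, expand, aeval_X, map_smul, Finsupp.coe_finsetSum,
    Finset.sum_apply, Finsupp.smul_apply, Finset.sum_smul, Finset.mul_sum]
  rw [Finset.sum_comm]
  refine Finset.sum_congr rfl fun i _ => Finset.sum_congr rfl fun j _ => ?_
  rw [aeval_C, ← Algebra.smul_def, smul_smul, smul_eq_mul]

theorem expand_basis (i : ι) :
    expand B (linForm (B i)) = HahnSeries.single (expo i) (1 : K) := by
  rw [expand_linForm, Finset.sum_eq_single i] <;> simp +contextual

/-- Passing to the coordinates of the basis B has a left inverse, and distinct monomials in these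
coordinates have distinct exponents, so no cancellation can occur. -/
theorem expand_injective : Function.Injective (expand B) := by
  let ψ : MvPolynomial ι K →ₐ[K] LexSeries K ι :=
    aeval fun i => HahnSeries.single (expo i) (1 : K)
  let θ : MvPolynomial (Fin s) K →ₐ[K] MvPolynomial ι K :=
    aeval fun j => ∑ i, B.repr (Pi.single j 1) i • X i
  let η : MvPolynomial ι K →ₐ[K] MvPolynomial (Fin s) K := aeval fun i => linForm (B i)
  have h1 : expand B = ψ.comp θ := by
    ext1 j
    simp [expand, ψ, θ]
  have h2 : η.comp θ = AlgHom.id K _ := by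
    ext1 j
    simp only [η, θ, AlgHom.comp_apply, aeval_X, map_sum, map_smul, AlgHom.id_apply]
    rw [← linForm_single, ← linFormL_apply]
    conv_rhs => rw [← B.sum_repr (Pi.single j (1 : K)), map_sum]
    exact Finset.sum_congr rfl fun i _ => by rw [map_smul, linFormL_apply]
  have hθ : Function.Injective θ := fun p q h => by
    have := congrArg η h
    rwa [← AlgHom.comp_apply, ← AlgHom.comp_apply, h2] at this
  let E (m : ι →₀ ℕ) : Lex (ιᵒᵈ → ℤ) := toLex fun i => (m (OrderDual.ofDual i) : ℤ)
  have hE : Function.Injective E := fun m n h => by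
    ext i
    have := congrFun (toLex.injective h) (OrderDual.toDual i)
    exact_mod_cast this
  have hmon (m : ι →₀ ℕ) : ψ (monomial m 1) = HahnSeries.single (E m) (1 : K) := by
    induction m using Finsupp.induction_linear with
    | zero => 
      have : E 0 = 0 := rfl
      rw [this]
      exact map_one ψ
    | add f g hf hg =>
      have : E (f + g) = E f + E g := by
        refine ofLex.injective (funext fun k => ?_)
        change ((f + g) (OrderDual.ofDual k) : ℤ) =
          (f (OrderDual.ofDual k) : ℤ) + (g (OrderDual.ofDual k) : ℤ)
        simp
      rw [show monomial (f + g) (1 : K) = monomial f 1 * monomial g 1 by simp [monomial_mul],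
        map_mul, hf, hg, HahnSeries.single_mul_single, this, one_mul]
    | single i e =>
      have : E (Finsupp.single i e) = e • expo i := by
        refine ofLex.injective (funext fun k => ?_)
        change ((Finsupp.single i e (OrderDual.ofDual k) : ℕ) : ℤ) =
          e • (Pi.single (OrderDual.toDual i) 1 : ιᵒᵈ → ℤ) k
        by_cases hk : i = OrderDual.ofDual k
        · rw [hk, OrderDual.toDual_ofDual]
          simp
        · have : k ≠ OrderDual.toDual i := fun h => hk (by simp [h])
          simp [hk, this]
      rw [← X_pow_eq_monomial, map_pow, aeval_X, HahnSeries.single_pow, one_pow, this]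
  have hψ : Function.Injective ψ := by
    rw [injective_iff_map_eq_zero]
    intro p hp
    ext m
    have h3 := congrArg (fun x => HahnSeries.coeff x (E m)) hp
    rw [p.as_sum, map_sum] at h3
    simp only [HahnSeries.coeff_sum, HahnSeries.coeff_zero] at h3
    rw [coeff_zero, ← h3, Finset.sum_eq_single m]
    · rw [← mul_one (coeff m p), ← smul_eq_mul, ← smul_monomial, map_smul, hmon]
      simp
    · intro n _ hn
      rw [← mul_one (coeff n p), ← smul_eq_mul, ← smul_monomial, map_smul, hmon]
      simp [HahnSeries.coeff_single_of_ne (hE.ne hn.symm)]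
    · intro hm
      simp [notMem_support_iff.1 hm]
  rw [h1]
  exact hψ.comp hθ

/-- Expansion of rational functions. -/
noncomputable def expandRat : RatU K s →ₐ[K] LexSeries K ι :=
  IsFractionRing.liftAlgHom (expand_injective B)

theorem expandRat_algebraMap (p : MvPolynomial (Fin s) K) :
    expandRat B (algebraMap _ _ p) = expand B p := by
  simp [expandRat, IsFractionRing.liftAlgHom_apply]

theorem expand_mem_suppSubalgebra {S : AddSubmonoid (Lex (ιᵒᵈ → ℤ))} (hS : ∀ i : ι, expo i ∈ S)
    (p : MvPolynomial (Fin s) K) : expand B p ∈ suppSubalgebra K S := by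
  induction p using MvPolynomial.induction_on with
  | C c => 
    rw [← algebraMap_eq, AlgHom.commutes]
    exact algebraMap_mem _ c
  | add p q hp hq => rw [map_add]; exact add_mem hp hq
  | mul_X p j hp =>
    rw [map_mul]
    refine mul_mem hp ?_
    rw [expand, aeval_X]
    exact sum_mem fun i _ => Subalgebra.smul_mem _ (single_mem_suppSubalgebra (hS i) _) _

/-- `v` has the leading coordinate `e`. -/
def HasLead (v : Fin s → K) (e : ι) : Prop := B.repr v e ≠ 0 ∧ ∀ i < e, B.repr v i = 0

theorem exists_hasLead {v : Fin s → K} (hv : v ≠ 0) : ∃ e, HasLead B v e := by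
  classical
  have h : (Finset.univ.filter fun i => B.repr v i ≠ 0).Nonempty := by
    by_contra h
    rw [Finset.not_nonempty_iff_eq_empty, Finset.filter_eq_empty_iff] at h
    apply hv
    apply B.repr.injective
    ext i
    simpa using h (Finset.mem_univ i)
  refine ⟨_, (Finset.mem_filter.1 (Finset.min'_mem _ h)).2, fun i hi => ?_⟩
  by_contra h1
  exact absurd (Finset.min'_le _ i (Finset.mem_filter.2 ⟨Finset.mem_univ _, h1⟩)) (not_le.2 hi)

/-- Factoring out the dominant term gives v = β z_e (1 - u), where u is a combination of the
infinitesimals z_i / z_e with i > e. What remains of 1 / v after multiplication by z_e is β⁻¹ (1 -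
u)⁻¹. The submonoid S is left free, since two different choices are needed. -/
theorem expand_inv_mem {S : AddSubmonoid (Lex (ιᵒᵈ → ℤ))} {v : Fin s → K} {e : ι}
    (hv : HasLead B v e) (hS : ∀ i > e, expo i - expo e ∈ S) :
    (expand B (linForm v))⁻¹ * HahnSeries.single (expo e) 1 ∈ suppSubalgebra K S := by
  classical
  set β := B.repr v e with hβ
  have hβ0 : β ≠ 0 := hv.1
  set u : LexSeries K ι := ∑ i ∈ Finset.univ.filter (e < ·),
    (-(β⁻¹ * B.repr v i)) • HahnSeries.single (expo i - expo e) (1 : K) with hu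
  have h1 : expand B (linForm v) = β • (HahnSeries.single (expo e) 1 * (1 - u)) := by
    rw [expand_linForm, hu, mul_sub, mul_one, Finset.mul_sum, smul_sub, Finset.smul_sum,
      sub_eq_add_neg, ← Finset.sum_neg_distrib, ← Finset.add_sum_erase _ _ (Finset.mem_univ e)]
    congr 1
    refine (Finset.sum_subset (s₁ := Finset.univ.filter (e < ·)) (fun i hi => ?_)
      fun i hi hi' => ?_).symm.trans (Finset.sum_congr rfl fun i _ => ?_)
    · exact Finset.mem_erase.2 ⟨(Finset.mem_filter.1 hi).2.ne', Finset.mem_univ _⟩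
    · simp only [Finset.mem_filter, Finset.mem_univ, true_and] at hi'
      rw [hv.2 i (lt_of_le_of_ne (not_lt.1 hi') (Finset.ne_of_mem_erase hi)), zero_smul]
    · rw [mul_smul_comm, HahnSeries.single_mul_single, add_sub_cancel, one_mul, smul_smul,
        ← neg_smul]
      congr 1
      field_simp
  have hus {T : AddSubmonoid (Lex (ιᵒᵈ → ℤ))} (hT : ∀ i > e, expo i - expo e ∈ T) :
      u ∈ suppSubalgebra K T :=
    sum_mem fun i hi => Subalgebra.smul_mem _
      (single_mem_suppSubalgebra (hT i (Finset.mem_filter.1 hi).2) _) _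
  have hpos : 0 < u.orderTop := by
    refine orderTop_pos fun g hg => ?_
    rw [HahnSeries.mem_support, hu, HahnSeries.coeff_sum] at hg
    obtain ⟨i, hi, hg⟩ := Finset.exists_ne_zero_of_sum_ne_zero hg
    rw [HahnSeries.coeff_smul, HahnSeries.coeff_single] at hg
    split_ifs at hg with h
    · rw [h, sub_pos]
      exact expo_lt (Finset.mem_filter.1 hi).2
    · simp at hg
  have h2 : (expand B (linForm v))⁻¹ * HahnSeries.single (expo e) 1 = β⁻¹ • (1 - u)⁻¹ := by
    have h3 : (HahnSeries.single (expo e) 1 : LexSeries K ι) ≠ 0 := by simp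
    rw [h1, Algebra.smul_def, Algebra.smul_def, mul_inv, mul_inv, map_inv₀]
    field_simp
  rw [h2]
  exact Subalgebra.smul_mem _ (inv_one_sub_mem_suppSubalgebra (hus hS) hpos) _

/-- The coefficient of `∏ z_i⁻¹`. -/
noncomputable def residue : RatU K s →ₗ[K] K where
  toFun r := (expandRat B r).coeff (toLex fun _ => -1)
  map_add' := by simp
  map_smul' := by simp

/-- The rational functions whose denominators are products of elements of `W`. -/
noncomputable def polesIn (W : Submodule K (Fin s → K)) :
    Subalgebra (MvPolynomial (Fin s) K) (RatU K s) :=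
  Algebra.adjoin _ {r | ∃ v ∈ W, r = (algebraMap _ (RatU K s) (linForm v))⁻¹}

/-- The sums of rational functions whose denominators are products of vectors that do not
span `V`. -/
noncomputable def lowerPoles (K : Type*) [Field K] (s : ℕ) : Submodule K (RatU K s) :=
  ⨆ (W : Submodule K (Fin s → K)) (_ : W ≠ ⊤), (Subalgebra.toSubmodule (polesIn W)).restrictScalars K

theorem polesIn_le_lowerPoles {W : Submodule K (Fin s → K)} (hW : W ≠ ⊤) {r : RatU K s}
    (hr : r ∈ polesIn W) : r ∈ lowerPoles K s :=
  le_iSup₂_of_le (f := fun (W : Submodule K (Fin s → K)) (_ : W ≠ ⊤) =>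
    (Subalgebra.toSubmodule (polesIn W)).restrictScalars K) W hW le_rfl hr

/-- If every index were the leading index of a vector of W, elimination from the largest index
downwards would put every basis vector into W. -/
theorem exists_not_hasLead {W : Submodule K (Fin s → K)} (hW : W ≠ ⊤) :
    ∃ e, ∀ v ∈ W, ¬ HasLead B v e := by
  by_contra! h
  apply hW
  rw [eq_top_iff, ← B.span_eq, Submodule.span_le]
  rintro _ ⟨e, rfl⟩
  induction e using WellFoundedGT.induction with
  | _ e ih =>
  obtain ⟨v, hv, hv1, hv2⟩ := h e
  have h1 : B e = (B.repr v e)⁻¹ • (v - ∑ i ∈ Finset.univ.erase e, B.repr v i • B i) := by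
    rw [eq_comm, inv_smul_eq_iff₀ hv1, sub_eq_iff_eq_add,
      Finset.add_sum_erase _ (fun i => B.repr v i • B i) (Finset.mem_univ e), B.sum_repr]
  rw [h1]
  refine W.smul_mem _ (W.sub_mem hv (W.sum_mem fun i hi => ?_))
  rcases lt_or_gt_of_ne (Finset.ne_of_mem_erase hi) with h2 | h2
  · rw [hv2 i h2, zero_smul]; exact W.zero_mem
  · exact W.smul_mem _ (ih i h2)

/-- Choose an index e that leads no vector of W. Inverting vectors of W then never produces a
negative power of z_e, while the residue is read at exponent -1 in z_e. -/
theorem residue_lowerPoles {r : RatU K s} (hr : r ∈ lowerPoles K s) : residue B r = 0 := by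
  suffices h : lowerPoles K s ≤ LinearMap.ker (residue B) from h hr
  refine iSup₂_le fun W hW r hr => ?_
  obtain ⟨e, he⟩ := exists_not_hasLead B hW
  let S : AddSubmonoid (Lex (ιᵒᵈ → ℤ)) :=
    { carrier := {m | 0 ≤ ofLex m (OrderDual.toDual e)}
      add_mem' := fun {a b} ha hb => by
        change 0 ≤ ofLex a (OrderDual.toDual e) + ofLex b (OrderDual.toDual e)
        exact add_nonneg ha hb
      zero_mem' := by
        change (0 : ℤ) ≤ 0
        exact le_rfl }
  have hS0 (i : ι) : expo i ∈ S := by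
    change 0 ≤ (Pi.single (OrderDual.toDual i) 1 : ιᵒᵈ → ℤ) (OrderDual.toDual e)
    rw [Pi.single_apply]; split_ifs <;> simp
  have hS1 (i : ι) (hi : i ≠ e) : -expo i ∈ S := by
    change 0 ≤ -(Pi.single (OrderDual.toDual i) 1 : ιᵒᵈ → ℤ) (OrderDual.toDual e)
    rw [Pi.single_eq_of_ne (fun h => hi (OrderDual.toDual.injective h).symm), neg_zero]
  have h1 : expandRat B r ∈ suppSubalgebra K S := by
    have hr' : r ∈ polesIn W := hr
    clear hr
    induction hr' using Algebra.adjoin_induction with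
    | mem r hr =>
      obtain ⟨v, hv, rfl⟩ := hr
      rw [map_inv₀, expandRat_algebraMap]
      by_cases hv0 : v = 0
      · rw [hv0, ← linFormL_apply, map_zero, map_zero, inv_zero]
        exact zero_mem _
      obtain ⟨l, hl⟩ := exists_hasLead B hv0
      have hle : l ≠ e := fun h => he v hv (h ▸ hl)
      have h2 := mul_mem (expand_inv_mem B hl fun i _ => by
        rw [sub_eq_add_neg]; exact S.add_mem (hS0 i) (hS1 l hle))
        (single_mem_suppSubalgebra (hS1 l hle) (1 : K))
      rwa [mul_assoc, HahnSeries.single_mul_single, add_neg_cancel, one_mul,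
        show (HahnSeries.single 0 (1 : K) : LexSeries K ι) = 1 from rfl, mul_one] at h2
    | algebraMap p =>
      rw [expandRat_algebraMap]
      exact expand_mem_suppSubalgebra B hS0 p
    | add x y _ _ hx hy => rw [map_add]; exact add_mem hx hy
    | mul x y _ _ hx hy => rw [map_mul]; exact mul_mem hx hy
  by_contra h2
  have h3 : (0 : ℤ) ≤ -1 := h1 h2
  omega

/-- Once the leading monomials are multiplied in, all exponents are sums of differences `expo i -
expo l` with i > l, and the total of such a difference over the indices at least e is nonnegative.
Applied to the exponent -1 in all variables, this is the inequality between the two cardinalities.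
-/
theorem residue_prod_inv {κ : Type*} (c : Finset κ) (w : κ → Fin s → K) (l : κ → ι)
    (hl : ∀ j ∈ c, HasLead B (w j) (l j))
    (h : residue B (∏ j ∈ c, algebraMap _ (RatU K s) (linForm (w j)))⁻¹ ≠ 0) (e : ι) :
    (Finset.univ.filter (e ≤ ·)).card ≤ (c.filter (e ≤ l ·)).card := by
  let S : AddSubmonoid (Lex (ιᵒᵈ → ℤ)) :=
    { carrier := {m | 0 ≤ ∑ i ∈ Finset.univ.filter (e ≤ ·), ofLex m (OrderDual.toDual i)}
      add_mem' := fun {a b} ha hb => by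
        change 0 ≤ ∑ i ∈ Finset.univ.filter (e ≤ ·),
          (ofLex a (OrderDual.toDual i) + ofLex b (OrderDual.toDual i))
        rw [Finset.sum_add_distrib]
        exact add_nonneg ha hb
      zero_mem' := by
        change (0 : ℤ) ≤ ∑ i ∈ Finset.univ.filter (e ≤ ·), 0
        simp }
  have hexpo (i : ι) : ∑ k ∈ Finset.univ.filter (e ≤ ·), ofLex (expo i) (OrderDual.toDual k) =
      if e ≤ i then 1 else 0 := by
    simp [expo, Pi.single_apply, Finset.sum_ite_eq']
  have h1 : expandRat B (∏ j ∈ c, algebraMap _ (RatU K s) (linForm (w j)))⁻¹ *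
      HahnSeries.single (∑ j ∈ c, expo (l j)) 1 ∈ suppSubalgebra K S := by
    have h2 : (HahnSeries.single (∑ j ∈ c, expo (l j)) 1 : LexSeries K ι) =
        ∏ j ∈ c, HahnSeries.single (expo (l j)) 1 := by
      clear hl h
      induction c using Finset.cons_induction with
      | empty => rfl
      | cons j c hj ih =>
        rw [Finset.sum_cons, Finset.prod_cons, ← ih, HahnSeries.single_mul_single, one_mul]
    rw [h2, map_inv₀, map_prod, ← Finset.prod_inv_distrib, ← Finset.prod_mul_distrib]
    refine prod_mem fun j hj => ?_
    rw [expandRat_algebraMap]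
    refine expand_inv_mem B (hl j hj) fun i hi => ?_
    change 0 ≤ ∑ k ∈ Finset.univ.filter (e ≤ ·),
      (ofLex (expo i) (OrderDual.toDual k) - ofLex (expo (l j)) (OrderDual.toDual k))
    rw [Finset.sum_sub_distrib, hexpo, hexpo]
    split_ifs with h3 h4 h4
    · simp
    · simp
    · exact absurd (h4.trans hi.le) h3
    · simp
  have h3 : (toLex fun _ => -1) + ∑ j ∈ c, expo (l j) ∈ S := by
    refine h1 ?_
    rw [HahnSeries.mem_support, HahnSeries.coeff_mul_single_add, mul_one]
    exact h
  have h4 : (0 : ℤ) ≤ ∑ i ∈ Finset.univ.filter (e ≤ ·),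
    ((-1 : ℤ) + ofLex (∑ j ∈ c, expo (l j)) (OrderDual.toDual i)) := h3
  simp only [ofLex_sum_apply] at h4
  rw [Finset.sum_add_distrib, Finset.sum_comm] at h4
  simp only [hexpo] at h4
  simp only [Finset.sum_const, Finset.sum_boole, nsmul_eq_mul] at h4
  have : ((Finset.univ.filter (e ≤ ·)).card : ℤ) ≤ (c.filter (e ≤ l ·)).card := by linarith
  exact_mod_cast this

theorem residue_basis : residue B (∏ i, algebraMap _ (RatU K s) (linForm (B i)))⁻¹ = 1 := by
  have h2 : ∏ i, expand B (linForm (B i)) = HahnSeries.single (toLex fun _ => 1) 1 := by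
    simp only [expand_basis]
    have h3 : ∀ c : Finset ι, ∏ i ∈ c, (HahnSeries.single (expo i) 1 : LexSeries K ι) =
        HahnSeries.single (∑ i ∈ c, expo i) 1 := by
      intro c
      induction c using Finset.cons_induction with
      | empty => rfl
      | cons j c hj ih =>
        rw [Finset.sum_cons, Finset.prod_cons, ih, HahnSeries.single_mul_single, one_mul]
    rw [h3]
    congr 2
    refine ofLex.injective (funext fun k => ?_)
    rw [ofLex_sum_apply]
    change ∑ i, (Pi.single (OrderDual.toDual i) 1 : ιᵒᵈ → ℤ) k = 1
    rw [Finset.sum_eq_single (OrderDual.ofDual k)]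
    · simp
    · intro i _ hi
      exact Pi.single_eq_of_ne (fun h => hi (by simp [h])) _
    · simp
  change (expandRat B _).coeff _ = 1
  rw [map_inv₀, map_prod]
  simp only [expandRat_algebraMap]
  rw [h2, HahnSeries.inv_single, inv_one]
  exact HahnSeries.coeff_single_same _ _

end Residue

/-! ### Rational functions modulo lower poles, and independence of the no broken bases. -/

section LowerPoles

variable {K : Type*} [Field K] {s N : ℕ}

theorem mul_mem_lowerPoles (f : MvPolynomial (Fin s) K) {r : RatU K s} (hr : r ∈ lowerPoles K s) :
    algebraMap _ (RatU K s) f * r ∈ lowerPoles K s := by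
  suffices h : lowerPoles K s ≤
      (lowerPoles K s).comap (LinearMap.mulLeft K (algebraMap _ (RatU K s) f)) from h hr
  refine iSup₂_le fun W hW r hr => polesIn_le_lowerPoles hW ?_
  exact mul_mem (algebraMap_mem _ f) (show r ∈ polesIn W from hr)

theorem ratPartial_mem_lowerPoles (j : Fin s) {r : RatU K s} (hr : r ∈ lowerPoles K s) :
    ratPartial j r ∈ lowerPoles K s := by
  suffices h : lowerPoles K s ≤ (lowerPoles K s).comap (ratPartial j).toLinearMap from h hr
  refine iSup₂_le fun W hW r hr => polesIn_le_lowerPoles hW ?_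
  have hr' : r ∈ polesIn W := hr
  clear hr
  change ratPartial j r ∈ polesIn W
  induction hr' using Algebra.adjoin_induction with
  | mem r hr =>
    have hr' : r ∈ polesIn W := Algebra.subset_adjoin hr
    obtain ⟨v, hv, rfl⟩ := hr
    rw [Derivation.leibniz_inv, ratPartial_algebraMap, smul_eq_mul]
    exact mul_mem (neg_mem (pow_mem hr' 2)) (algebraMap_mem _ _)
  | algebraMap p => rw [ratPartial_algebraMap]; exact algebraMap_mem _ _
  | add x y _ _ hx hy => rw [map_add]; exact add_mem hx hy
  | mul x y h1 h2 hx hy =>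
    rw [Derivation.leibniz]
    exact add_mem (mul_mem h1 hy) (mul_mem h2 hx)

theorem ratDiffHom_mem_lowerPoles (p : MvPolynomial (Fin s) K) {r : RatU K s}
    (hr : r ∈ lowerPoles K s) : ratDiffHom p r ∈ lowerPoles K s := by
  induction p using MvPolynomial.induction_on generalizing r with
  | C c => rw [ratDiffHom_C]; exact Submodule.smul_mem _ _ hr
  | add p q hp hq => rw [map_add]; exact add_mem (hp hr) (hq hr)
  | mul_X p j hp =>
    rw [map_mul, Module.End.mul_apply, ratDiffHom_X]
    exact hp (ratPartial_mem_lowerPoles j hr)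

/-- This is the Weyl algebra relation [p(∂), y_j] = (∂_j p)(∂). -/
theorem X_mul_ratDiffHom (j : Fin s) (p : MvPolynomial (Fin s) K) (r : RatU K s) :
    algebraMap (MvPolynomial (Fin s) K) (RatU K s) (X j) * ratDiffHom p r =
      ratDiffHom p (algebraMap (MvPolynomial (Fin s) K) (RatU K s) (X j) * r) - ratDiffHom (pderiv j p) r := by
  induction p using MvPolynomial.induction_on generalizing r with
  | C c => simp
  | add p q hp hq => simp only [map_add, LinearMap.add_apply, mul_add, hp, hq]; ring
  | mul_X p i hp =>
    rw [pderiv_mul]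
    simp only [map_mul, map_add, Module.End.mul_apply, LinearMap.add_apply, ratDiffHom_X, hp,
      Derivation.leibniz, ratPartial_algebraMap, pderiv_X, smul_eq_mul]
    by_cases h : j = i
    · subst h
      simp
    · simp [h, Ne.symm h]

/-- Since y_j f vanishes modulo lower poles, the Weyl relation reduces y_j p(∂) f to -(∂_j p)(∂) f.
Multiplication by y_j thus acts on the coefficient p as -∂_j, which is why g enters through its
reflection. -/
theorem mul_ratDiffHom_sub_mem {f : RatU K s}
    (hf : ∀ j, algebraMap (MvPolynomial (Fin s) K) (RatU K s) (X j) * f ∈ lowerPoles K s)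
    (g p : MvPolynomial (Fin s) K) :
    algebraMap _ (RatU K s) g * ratDiffHom p f - ratDiffHom (diffHom (reflect g) p) f ∈
      lowerPoles K s := by
  induction g using MvPolynomial.induction_on with
  | C c =>
    rw [reflect, aeval_C, algebraMap_eq, diffHom_C, map_smul, LinearMap.smul_apply,
      ← algebraMap_eq, ← IsScalarTower.algebraMap_apply, ← Algebra.smul_def, sub_self]
    exact zero_mem _
  | add g h hg hh =>
    rw [reflect, map_add, map_add, map_add, add_mul, LinearMap.add_apply, map_add,
      LinearMap.add_apply, add_sub_add_comm]
    exact add_mem hg hh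
  | mul_X g j hg =>
    have h1 : diffHom (reflect (g * X j)) p = -pderiv j (diffHom (reflect g) p) := by
      simp only [reflect, map_mul, aeval_X]
      rw [← map_mul, mul_comm, map_mul, Module.End.mul_apply, map_neg, LinearMap.neg_apply,
        diffHom_X]
    have h2 := add_mem (mul_mem_lowerPoles (X j) hg)
      (ratDiffHom_mem_lowerPoles (diffHom (reflect g) p) (hf j))
    convert h2 using 1
    rw [h1, map_neg, LinearMap.neg_apply, map_mul, mul_sub, X_mul_ratDiffHom]
    ring

theorem invProd_mem_lowerPoles {a : Fin N → Fin s → K} {Y : Finset (Fin N)}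
    (h : Submodule.span K (a '' (Y : Set (Fin N))) ≠ ⊤) : invProd a Y ∈ lowerPoles K s := by
  refine polesIn_le_lowerPoles h ?_
  rw [invProd, listProd, map_prod, ← Finset.prod_inv_distrib]
  exact prod_mem fun i hi => Algebra.subset_adjoin
    ⟨a i, Submodule.subset_span ⟨i, hi, rfl⟩, rfl⟩

theorem algebraMap_linForm_ne_zero {v : Fin s → K} (hv : v ≠ 0) :
    algebraMap _ (RatU K s) (linForm v) ≠ 0 := by
  simpa using linForm_ne_zero hv

theorem listProd_mul_invProd {a : Fin N → Fin s → K} {Y Z : Finset (Fin N)}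
    (ha : ∀ i ∈ Y, a i ≠ 0) (hd : Disjoint Y Z) :
    algebraMap _ (RatU K s) (listProd a Y) * invProd a (Y ∪ Z) = invProd a Z := by
  have h : algebraMap _ (RatU K s) (listProd a Y) ≠ 0 := by
    rw [listProd, map_prod]
    exact Finset.prod_ne_zero_iff.2 fun i hi => algebraMap_linForm_ne_zero (ha i hi)
  rw [invProd, listProd_union a hd, map_mul, mul_inv, ← mul_assoc, mul_inv_cancel₀ h, one_mul,
    invProd]

theorem IsBasisSub.ne_zero {a : Fin N → Fin s → K} {b : Finset (Fin N)} (hb : IsBasisSub a b) :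
    ∀ i ∈ b, a i ≠ 0 := fun _ hi => hb.1.ne_zero hi

theorem IsBasisSub.span_erase_ne_top {a : Fin N → Fin s → K} {b : Finset (Fin N)}
    (hb : IsBasisSub a b) {i : Fin N} (hi : i ∈ b) :
    Submodule.span K (a '' ((b.erase i : Finset (Fin N)) : Set (Fin N))) ≠ ⊤ := by
  intro h
  refine hb.1.notMem_span hi ?_
  rw [← Finset.coe_erase, h]
  exact Submodule.mem_top

/-- Each y_j is a combination of the vectors of b, and each of these cancels one factor of the
denominator; the remaining vectors no longer span. -/
theorem X_mul_invProd_mem {a : Fin N → Fin s → K} {b : Finset (Fin N)} (hb : IsBasisSub a b)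
    (j : Fin s) : algebraMap (MvPolynomial (Fin s) K) (RatU K s) (X j) * invProd a b ∈ lowerPoles K s := by
  let φ : (Fin s → K) →ₗ[K] RatU K s := (LinearMap.mulRight K (invProd a b)) ∘ₗ
    (Algebra.linearMap (MvPolynomial (Fin s) K) (RatU K s)).restrictScalars K ∘ₗ linFormL
  suffices h : (⊤ : Submodule K (Fin s → K)) ≤ (lowerPoles K s).comap φ by
    have := h (Submodule.mem_top (x := Pi.single j 1))
    simpa [φ, linForm_single] using this
  rw [← hb.2, Submodule.span_le]
  rintro _ ⟨i, hi, rfl⟩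
  change algebraMap _ (RatU K s) (linForm (a i)) * invProd a b ∈ lowerPoles K s
  have h1 := listProd_mul_invProd (a := a) (Y := {i}) (Z := b.erase i)
    (by simpa using hb.ne_zero i hi) (by simp)
  rw [← Finset.insert_eq, Finset.insert_erase hi] at h1
  rw [listProd, Finset.prod_singleton] at h1
  rw [h1]
  exact invProd_mem_lowerPoles (hb.span_erase_ne_top hi)

/-- A basis extracted from the list, as a basis of `V`. -/
noncomputable def IsBasisSub.basis {a : Fin N → Fin s → K} {b : Finset (Fin N)}
    (hb : IsBasisSub a b) : Module.Basis b K (Fin s → K) :=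
  Module.Basis.mk (v := fun i : b => a i) hb.1 (by
    rw [← hb.2, Set.image_eq_range]; rfl)

@[simp] theorem IsBasisSub.basis_apply {a : Fin N → Fin s → K} {b : Finset (Fin N)}
    (hb : IsBasisSub a b) (i : b) : hb.basis i = a i := Module.Basis.mk_apply ..

theorem residue_invProd_self {a : Fin N → Fin s → K} {b : Finset (Fin N)} (hb : IsBasisSub a b) :
    residue hb.basis (invProd a b) = 1 := by
  rw [invProd, listProd, map_prod, ← Finset.prod_coe_sort, ← residue_basis hb.basis]
  simp

/-- If the residue did not vanish, every e in b would lie in c, and both have s elements. The count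
of leading indices supplies enough vectors of c inside the span F of the part of b from e on, so
these vectors span F. Since b and c are broken only by their own elements, this forces e into c. -/
theorem residue_invProd_of_ne {a : Fin N → Fin s → K} {b c : Finset (Fin N)}
    (hb : IsNoBroken a b) (hc : IsNoBroken a c) (hbc : b ≠ c) :
    residue hb.1.basis (invProd a c) = 0 := by
  classical
  by_contra h
  apply hbc
  refine Finset.eq_of_subset_of_card_le (fun e he => ?_) (by rw [hb.1.card_eq, hc.1.card_eq])
  have hne : Nonempty b := ⟨⟨e, he⟩⟩
  have hl (j : Fin N) : ∃ l, j ∈ c → HasLead hb.1.basis (a j) l := by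
    by_cases hj : j ∈ c
    · obtain ⟨l, hl⟩ := exists_hasLead hb.1.basis (hc.1.ne_zero j hj)
      exact ⟨l, fun _ => hl⟩
    · exact ⟨hne.some, fun h => absurd h hj⟩
  choose l hl using hl
  rw [invProd, listProd, map_prod] at h
  have h1 := residue_prod_inv hb.1.basis c a l hl h ⟨e, he⟩
  set J := c.filter fun j => ⟨e, he⟩ ≤ l j with hJ
  set F := Submodule.span K (a '' {i | i ∈ b ∧ e ≤ i}) with hF
  have hJF (j : Fin N) (hj : j ∈ J) : a j ∈ F := by
    obtain ⟨hjc, hje⟩ := Finset.mem_filter.1 hj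
    rw [← hb.1.basis.sum_repr (a j)]
    refine F.sum_mem fun i _ => ?_
    by_cases hi : (⟨e, he⟩ : b) ≤ i
    · refine F.smul_mem _ (Submodule.subset_span ⟨i, ⟨i.2, hi⟩, ?_⟩)
      rw [hb.1.basis_apply]
    · rw [(hl j hjc).2 i ((not_le.1 hi).trans_le hje), zero_smul]
      exact F.zero_mem
  have hcard : Module.finrank K F ≤ J.card := by
    refine le_trans ?_ h1
    have := finrank_span_finset_le_card (R := K) ((b.filter (e ≤ ·)).image a)
    rw [Finset.coe_image, Finset.coe_filter] at this
    refine this.trans (Finset.card_image_le.trans ?_)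
    refine (Finset.card_le_card_of_surjOn (fun i : b => (i : Fin N)) ?_)
    intro i hi
    have := Finset.mem_filter.1 hi
    exact ⟨⟨i, this.1⟩, by simpa using this.2, rfl⟩
  have hspan : Submodule.span K (a '' (J : Set (Fin N))) = F := by
    have hi : LinearIndepOn K a (J : Set (Fin N)) := hc.1.1.mono (by
      intro j hj; exact (Finset.mem_filter.1 hj).1)
    refine Submodule.eq_of_le_of_finrank_le (Submodule.span_le.2 ?_) (hcard.trans ?_)
    · rintro _ ⟨j, hj, rfl⟩
      exact hJF j hj
    · have h2 := finrank_span_eq_card (R := K) (b := fun j : (J : Set (Fin N)) => a j) hi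
      rw [Set.image_eq_range, h2]
      simp
  have heF : a e ∈ F := Submodule.subset_span ⟨e, ⟨he, le_rfl⟩, rfl⟩
  have hJne : J.Nonempty := by
    rw [← Finset.card_pos]
    refine lt_of_lt_of_le (Finset.card_pos.2 ⟨⟨e, he⟩, ?_⟩) h1
    simp
  set j₀ := J.min' hJne
  have hj₀ := J.min'_mem hJne
  -- If j₀ < e, then j₀ breaks b and so belongs to b; but a vector of b before e cannot lie in the
  -- span of those from e on.
  have hej : e ≤ j₀ := by
    by_contra hlt
    rw [not_le] at hlt
    have hj₀b : j₀ ∈ b := (hb.2 j₀).1 ⟨e, he, hlt.le, hJF _ hj₀⟩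
    refine hb.1.1.notMem_span hj₀b (Submodule.span_mono (Set.image_mono ?_) (hJF _ hj₀))
    exact fun i hi => ⟨hi.1, fun h => (hlt.trans_le hi.2).ne' h⟩
  -- Now a e lies in the span of J, a part of c that starts at j₀ ≥ e, so e breaks c.
  refine (hc.2 e).1 ⟨j₀, (Finset.mem_filter.1 hj₀).1, hej, ?_⟩
  rw [← hspan] at heF
  refine Submodule.span_mono (Set.image_mono fun j hj => ?_) heF
  exact ⟨(Finset.mem_filter.1 hj).1, J.min'_le j hj⟩

/-- The residue along the basis b extracts the coefficient of b and vanishes on lower poles. -/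
theorem coeff_eq_zero_of_sum_invProd_mem {a : Fin N → Fin s → K} {l : NB a → K}
    (h : ∑ b, l b • invProd a b.1 ∈ lowerPoles K s) (b : NB a) : l b = 0 := by
  have h1 := residue_lowerPoles b.2.1.basis h
  rw [map_sum, Finset.sum_eq_single b] at h1
  · simpa [residue_invProd_self] using h1
  · intro c _ hc
    rw [map_smul, residue_invProd_of_ne b.2 c.2 fun h => hc (Subtype.ext h.symm), smul_zero]
  · simp

/-- Multiplication by y_j turns a relation with coefficients p_b into one with coefficients ∂_j p_b,
up to sign. Induction on the degree kills all partial derivatives; in degree 0 the residues decide.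
-/
theorem eq_zero_of_sum_ratDiffHom_mem [CharZero K] {a : Fin N → Fin s → K} {n : ℕ}
    {p : NB a → MvPolynomial (Fin s) K} (hp : ∀ b, (p b).IsHomogeneous n)
    (h : ∑ b, ratDiffHom (p b) (invProd a b.1) ∈ lowerPoles K s) (b : NB a) : p b = 0 := by
  induction n generalizing p b with
  | zero =>
    have h1 (b : NB a) := eq_C_of_isHomogeneous (hp b)
    have h2 : ∑ b : NB a, coeff 0 (p b) • invProd a b.1 ∈ lowerPoles K s := by
      convert h using 2 with b
      conv_rhs => rw [h1 b, ratDiffHom_C]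
    rw [h1 b, coeff_eq_zero_of_sum_invProd_mem h2, C_0]
  | succ n ih =>
    refine eq_zero_of_pderiv_eq_zero (hp b) fun j => ?_
    refine ih (p := fun b => pderiv j (p b)) (fun b => by simpa using (hp b).pderiv) ?_ b
    have h1 := sub_mem (sum_mem (t := Finset.univ) fun b _ =>
      ratDiffHom_mem_lowerPoles (p b) (X_mul_invProd_mem b.2.1 j)) (mul_mem_lowerPoles (X j) h)
    convert h1 using 1
    rw [Finset.mul_sum, ← Finset.sum_sub_distrib]
    refine Finset.sum_congr rfl fun b _ => ?_
    rw [X_mul_ratDiffHom, sub_sub_cancel]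

end LowerPoles

/-! ### No broken bases, and exchange arguments for the equations D_Y q = 0. -/

section Combinatorics

variable {K : Type*} [Field K] {s N : ℕ}

/-- A spanning sublist no element of which is broken from above is a no broken basis. -/
theorem isNoBroken_of_forall_notMem {a : Fin N → Fin s → K} {b : Finset (Fin N)}
    (hb : Submodule.span K (a '' (b : Set (Fin N))) = ⊤)
    (h : ∀ i, a i ∉ Submodule.span K (a '' ((b.filter (i < ·) : Finset (Fin N)) : Set (Fin N)))) :
    IsNoBroken a b := by
  classical
  have hi : LinearIndepOn K a (b : Set (Fin N)) := by
    rw [linearIndepOn_finset_iff]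
    intro f hf
    by_contra! hne
    obtain ⟨i, hib, hi⟩ := hne
    -- In a nontrivial relation, the vector of smallest index with nonzero coefficient is a
    -- combination of later vectors of b, which `h` forbids.
    set T := b.filter fun i => f i ≠ 0 with hT
    have hTne : T.Nonempty := ⟨i, Finset.mem_filter.2 ⟨hib, hi⟩⟩
    have hm := Finset.mem_filter.1 (T.min'_mem hTne)
    refine h (T.min' hTne) ?_
    rw [← Finset.add_sum_erase _ _ hm.1, add_eq_zero_iff_eq_neg] at hf
    rw [← inv_smul_smul₀ hm.2 (a _), hf]
    refine Submodule.smul_mem _ _ (neg_mem (Submodule.sum_mem _ fun l hl => ?_))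
    obtain ⟨hl1, hl2⟩ := Finset.mem_erase.1 hl
    by_cases hl0 : f l = 0
    · rw [hl0, zero_smul]; exact zero_mem _
    · refine Submodule.smul_mem _ _ (Submodule.subset_span ⟨l, ?_, rfl⟩)
      have := T.min'_le l (Finset.mem_filter.2 ⟨hl2, hl0⟩)
      simpa [hl2] using lt_of_le_of_ne this hl1.symm
  refine ⟨⟨hi, hb⟩, fun i => ⟨?_, fun hi => ⟨i, hi, le_rfl, Submodule.subset_span ⟨i, ⟨hi, le_rfl⟩, rfl⟩⟩⟩⟩
  rintro ⟨j, hj, hij, hmem⟩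
  rcases hij.eq_or_lt with rfl | hij
  · exact hj
  · refine absurd (Submodule.span_mono (Set.image_mono ?_) hmem) (h i)
    intro l hl
    simpa [hl.1] using hij.trans_le hl.2

theorem IsBasisSub.of_card {a : Fin N → Fin s → K} {b : Finset (Fin N)} (hb : b.card = s)
    (h : Submodule.span K (a '' (b : Set (Fin N))) = ⊤) : IsBasisSub a b := by
  refine ⟨?_, h⟩
  refine linearIndependent_of_top_le_span_of_card_eq_finrank (b := fun i : (b : Set (Fin N)) => a i)
    ?_ (by simp [hb])
  rw [← h, Set.image_eq_range]

theorem card_ge_of_span_eq_top {a : Fin N → Fin s → K} {b : Finset (Fin N)}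
    (h : Submodule.span K (a '' (b : Set (Fin N))) = ⊤) : s ≤ b.card := by
  classical
  have := finrank_span_finset_le_card (R := K) (b.image a)
  rw [Finset.coe_image, Set.finrank, h, finrank_top] at this
  simpa using this.trans Finset.card_image_le

theorem diffHom_listProd_eq_zero_of_cocircuit {a : Fin N → Fin s → K}
    {q : MvPolynomial (Fin s) K} (hq : q ∈ DX a) {Y : Finset (Fin N)}
    (hY : Submodule.span K (a '' (Y : Set (Fin N))) ≠ ⊤) :
    diffHom (listProd a Yᶜ) q = 0 := by
  simp only [DX, Submodule.mem_iInf, LinearMap.mem_ker] at hq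
  have := hq Yᶜ (by simpa [IsCocircuit] using hY)
  rwa [DOp, diffOp_eq] at this

/-- Equations for the no broken bases imply those for all sublists of `s` elements. -/
theorem diffHom_listProd_eq_zero_of_card {a : Fin N → Fin s → K}
    {q : MvPolynomial (Fin s) K} (hq : q ∈ DX a)
    (h : ∀ b : NB a, diffHom (listProd a (b.1)ᶜ) q = 0) (Y : Finset (Fin N)) (hY : Y.card = s) :
    diffHom (listProd a Yᶜ) q = 0 := by
  -- If the basis Y is broken, some a_i outside Y is a combination of vectors a_l of Y with l > i.
  -- Substituting this for the factor a_i of the complement replaces Y by the sets Y - l + i, whose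
  -- index sums are smaller.
  induction hn : ∑ i ∈ Y, (i : ℕ) using Nat.strong_induction_on generalizing Y with
  | _ n ih =>
  by_cases hs : Submodule.span K (a '' (Y : Set (Fin N))) = ⊤
  swap
  · exact diffHom_listProd_eq_zero_of_cocircuit hq hs
  by_cases hnb : IsNoBroken a Y
  · exact h ⟨Y, hnb⟩
  have hb := IsBasisSub.of_card hY hs
  obtain ⟨i, hi⟩ : ∃ i, a i ∈ Submodule.span K
      (a '' ((Y.filter (i < ·) : Finset (Fin N)) : Set (Fin N))) := by
    by_contra! h1
    exact hnb (isNoBroken_of_forall_notMem hs h1)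
  have hiY : i ∉ Y := fun hiY => by
    refine hb.1.notMem_span hiY (Submodule.span_mono (Set.image_mono fun l hl => ?_) hi)
    obtain ⟨h1, h2⟩ := Finset.mem_filter.1 hl
    exact ⟨h1, h2.ne'⟩
  rw [Submodule.mem_span_image_finset_iff_exists_fun'] at hi
  obtain ⟨c, hc⟩ := hi
  have hYi : Yᶜ = insert i (insert i Y)ᶜ := by
    ext j; by_cases hj : j = i <;> simp [hj, hiY]
  rw [hYi, listProd_insert a (by simp), ← linFormL_apply, ← hc, map_sum, Finset.sum_mul,
    map_sum, LinearMap.sum_apply]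
  refine Finset.sum_eq_zero fun l hl => ?_
  obtain ⟨hlY, hil⟩ := Finset.mem_filter.1 hl
  rw [map_smul, smul_mul_assoc, map_smul, LinearMap.smul_apply, linFormL_apply,
    ← listProd_insert a (by simp [hlY])]
  have h2 : insert l (insert i Y)ᶜ = (insert i (Y.erase l))ᶜ := by
    ext j
    by_cases hj : j = l
    · subst hj; simp [hil.ne']
    · simp [hj]
  have hi' : i ∉ Y.erase l := fun h => hiY (Finset.mem_of_mem_erase h)
  rw [h2, ih _ ?_ _ ?_ rfl, smul_zero]
  · rw [Finset.sum_insert hi', ← hn, ← Finset.add_sum_erase _ _ hlY]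
    exact Nat.add_lt_add_right hil _
  · rw [Finset.card_insert_of_notMem hi', Finset.card_erase_of_mem hlY]
    have := Finset.card_pos.2 ⟨l, hlY⟩
    omega

/-- An element of `D(X)` of the top degree is determined by the equations for the no broken
bases. -/
theorem eq_zero_of_mem_DXdeg [CharZero K] {a : Fin N → Fin s → K}
    (ha : Submodule.span K (Set.range a) = ⊤)
    {q : MvPolynomial (Fin s) K} (hq : q ∈ DXdeg a (N - s))
    (h : ∀ b : NB a, diffHom (listProd a (b.1)ᶜ) q = 0) : q = 0 := by
  obtain ⟨hq, hdeg⟩ := hq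
  rw [SetLike.mem_coe, mem_homogeneousSubmodule] at hdeg
  have hsN : s ≤ N := by
    have := card_ge_of_span_eq_top (a := a) (b := Finset.univ) (by simpa using ha)
    simpa using this
  -- For |Y| = s + n the polynomial D_{X∖Y} q has degree n. Its derivative along a_i, i ∈ Y, is D of
  -- the complement of Y - i applied to q, which vanishes by induction. If Y spans, all partial
  -- derivatives vanish; otherwise X∖Y is a cocircuit. The case Y = X is q = 0.
  have key (n : ℕ) : ∀ Y : Finset (Fin N), Y.card = s + n → diffHom (listProd a Yᶜ) q = 0 := by
    induction n with
    | zero => exact fun Y hY => diffHom_listProd_eq_zero_of_card hq h Y hY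
    | succ n ih =>
      intro Y hY
      by_cases hs : Submodule.span K (a '' (Y : Set (Fin N))) = ⊤
      swap
      · exact diffHom_listProd_eq_zero_of_cocircuit hq hs
      have hYN : Y.card ≤ N := by simpa using Y.card_le_univ
      have h1 : (diffHom (listProd a Yᶜ) q).IsHomogeneous (n + 1) := by
        refine diffHom_isHomogeneous (listProd_isHomogeneous a Yᶜ) ?_
        rw [Finset.card_compl, Fintype.card_fin]
        convert hdeg using 1
        omega
      refine eq_zero_of_pderiv_eq_zero h1 fun j => ?_
      let φ : (Fin s → K) →ₗ[K] MvPolynomial (Fin s) K :=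
        (LinearMap.applyₗ (diffHom (listProd a Yᶜ) q)) ∘ₗ diffHom.toLinearMap ∘ₗ linFormL
      have h2 : (⊤ : Submodule K (Fin s → K)) ≤ LinearMap.ker φ := by
        rw [← hs, Submodule.span_le]
        rintro _ ⟨i, hi, rfl⟩
        change diffHom (linForm (a i)) (diffHom (listProd a Yᶜ) q) = 0
        rw [← Module.End.mul_apply, ← map_mul, ← listProd_insert a (by simpa using hi)]
        have h3 : insert i Yᶜ = (Y.erase i)ᶜ := by
          ext j; by_cases hj : j = i <;> simp [hj]
        rw [h3]
        refine ih _ ?_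
        rw [Finset.card_erase_of_mem hi, hY]
        rfl
      have h3 : diffHom (linForm (Pi.single j 1)) (diffHom (listProd a Yᶜ) q) = 0 :=
        h2 (Submodule.mem_top (x := Pi.single j 1))
      rwa [linForm_single, diffHom_X] at h3
  have h1 := key (N - s) Finset.univ (by simp; omega)
  simpa [listProd] using h1

end Combinatorics

/-! ### Existence of the expansion over no broken bases. -/

section Existence

variable {K : Type*} [Field K] {s N : ℕ}

/-- The sums `∑ p_b(∂_y) (1 / ∏_{a ∈ b} a)` over the no broken bases, `p_b` homogeneous of
degree `n`. -/
noncomputable def polarSpan (a : Fin N → Fin s → K) (n : ℕ) : Submodule K (RatU K s) where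
  carrier := {r | ∃ p : NB a → MvPolynomial (Fin s) K, (∀ b, (p b).IsHomogeneous n) ∧
    r = ∑ b, ratDiffHom (p b) (invProd a b.1)}
  zero_mem' := ⟨0, fun _ => isHomogeneous_zero _ _ _, by simp⟩
  add_mem' := by
    rintro _ _ ⟨p, hp, rfl⟩ ⟨q, hq, rfl⟩
    exact ⟨p + q, fun b => (hp b).add (hq b), by simp [Finset.sum_add_distrib]⟩
  smul_mem' := by
    rintro c _ ⟨p, hp, rfl⟩
    exact ⟨c • p, fun b => Submodule.smul_mem (homogeneousSubmodule (Fin s) K n) c (hp b),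
      by simp [Finset.smul_sum]⟩

/-- The rational function `1 / ∏ a_i ^ m_i`. -/
noncomputable def invPow (a : Fin N → Fin s → K) (m : Fin N → ℕ) : RatU K s :=
  (∏ i, algebraMap _ (RatU K s) (linForm (a i)) ^ m i)⁻¹

theorem invPow_single_mul {a : Fin N → Fin s → K} (m : Fin N → ℕ) (i : Fin N) :
    invPow a (m + Pi.single i 1) = (algebraMap _ (RatU K s) (linForm (a i)))⁻¹ * invPow a m := by
  classical
  rw [invPow, invPow, ← mul_inv]
  congr 1
  simp only [Pi.add_apply, pow_add, Finset.prod_mul_distrib]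
  rw [mul_comm]
  congr 1
  rw [Finset.prod_eq_single i] <;> simp +contextual

/-- The vector u holds the coefficients of the coordinate function dual to a_i, so that
differentiation in the direction u affects no other factor of the denominator. -/
theorem exists_dual_vector {a : Fin N → Fin s → K} {b : Finset (Fin N)} (hb : IsBasisSub a b)
    {i : Fin N} (hi : i ∈ b) : ∃ u : Fin s → K, ∀ l ∈ b, ∑ j, u j * a l j = if l = i then 1 else 0 := by
  refine ⟨fun j => hb.basis.repr (Pi.single j 1) ⟨i, hi⟩, fun l hl => ?_⟩
  have h : hb.basis.coord ⟨i, hi⟩ (a l) = if l = i then 1 else 0 := by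
    have := hb.basis_apply ⟨l, hl⟩
    rw [← this, Module.Basis.coord_apply, Module.Basis.repr_self, Finsupp.single_apply]
    simp
  rw [← h]
  conv_rhs => rw [pi_eq_sum_univ' (a l), map_sum]
  refine Finset.sum_congr rfl fun j _ => ?_
  rw [map_smul, smul_eq_mul, mul_comm, Module.Basis.coord_apply]
  
theorem derivation_sum_apply {κ : Type*} (T : Finset κ)
    (D : κ → Derivation K (RatU K s) (RatU K s)) (r : RatU K s) :
    (∑ j ∈ T, D j) r = ∑ j ∈ T, D j r := by
  induction T using Finset.cons_induction with
  | empty => simp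
  | cons j T hj ih => rw [Finset.sum_cons, Finset.sum_cons, Derivation.add_apply, ih]

theorem derivation_prod_eq_zero (D : Derivation K (RatU K s) (RatU K s)) {κ : Type*} (T : Finset κ)
    (f : κ → RatU K s) (h : ∀ i ∈ T, D (f i) = 0) : D (∏ i ∈ T, f i) = 0 := by
  induction T using Finset.cons_induction with
  | empty => simp
  | cons i T hi ih =>
    rw [Finset.prod_cons, Derivation.leibniz, ih fun j hj => h j (Finset.mem_cons_of_mem hj),
      h i (Finset.mem_cons_self i T)]
    simp

/-- Differentiating along the dual vector of a_i sends a pole of order k in a_i to -k times one of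
order k + 1. In characteristic 0 this builds every denominator supported on b from the one with all
orders 1. -/
theorem exists_ratDiffHom_eq_invPow [CharZero K] {a : Fin N → Fin s → K} {b : Finset (Fin N)}
    (hb : IsBasisSub a b) (n : ℕ) (m : Fin N → ℕ) (hm : ∀ i, m i ≠ 0 ↔ i ∈ b)
    (hn : ∑ i, m i = n + s) :
    ∃ p : MvPolynomial (Fin s) K, p.IsHomogeneous n ∧ invPow a m = ratDiffHom p (invProd a b) := by
  classical
  have hsum : ∑ i, m i = ∑ i ∈ b, m i := by
    rw [← Finset.sum_subset (Finset.subset_univ b)]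
    intro i _ hi
    by_contra h
    exact hi ((hm i).1 h)
  induction n generalizing m with
  | zero =>
    refine ⟨1, isHomogeneous_one _ _, ?_⟩
    have h1 : ∀ i ∈ b, 1 = m i := by
      rw [← Finset.sum_eq_sum_iff_of_le fun i hi => Nat.one_le_iff_ne_zero.2 ((hm i).2 hi)]
      rw [← hsum, hn, zero_add, Finset.sum_const, hb.card_eq, smul_eq_mul, mul_one]
    rw [map_one, Module.End.one_apply, invPow, invProd, listProd, map_prod,
      ← Finset.prod_subset (Finset.subset_univ b)]
    · congr 1
      exact Finset.prod_congr rfl fun i hi => by rw [← h1 i hi, pow_one]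
    · intro i _ hi
      have : m i = 0 := by by_contra h; exact hi ((hm i).1 h)
      rw [this, pow_zero]
  | succ n ih =>
    -- The exponents add up to more than the s elements of b, so one of them exceeds 1 and can be
    -- lowered without leaving the support b.
    obtain ⟨i, hi, hmi⟩ : ∃ i ∈ b, 1 < m i := by
      by_contra! h
      have := Finset.sum_le_sum h
      rw [← hsum, hn, Finset.sum_const, hb.card_eq, smul_eq_mul, mul_one] at this
      omega
    set m' : Fin N → ℕ := m - Pi.single i 1 with hm'
    have hmm : m = m' + Pi.single i 1 := by
      ext j
      by_cases hj : j = i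
      · subst hj; simp [m']; omega
      · simp [m', hj]
    have hm'b : ∀ j, m' j ≠ 0 ↔ j ∈ b := by
      intro j
      rw [← hm j]
      by_cases hj : j = i
      · subst hj; simp [m']; omega
      · simp [m', hj]
    have hm'n : ∑ j, m' j = n + s := by
      have : ∑ j, m j = ∑ j, m' j + 1 := by
        rw [hmm]; simp [Finset.sum_add_distrib]
      omega
    obtain ⟨p, hp, hpm⟩ := ih m' hm'b hm'n (by
      rw [← Finset.sum_subset (Finset.subset_univ b)]
      intro i _ hi
      by_contra h
      exact hi ((hm'b i).1 h))
    obtain ⟨u, hu⟩ := exists_dual_vector hb hi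
    let D : Derivation K (RatU K s) (RatU K s) := ∑ j, u j • ratPartial j
    have hD (r : RatU K s) : D r = ratDiffHom (linForm u) r := by
      simp [D, linForm, derivation_sum_apply, map_sum]
    have hDa (l : Fin N) (hl : l ∈ b) :
        D (algebraMap _ (RatU K s) (linForm (a l))) = if l = i then 1 else 0 := by
      have h1 := congrArg (algebraMap K (RatU K s)) (hu l hl)
      have h2 : D (algebraMap _ (RatU K s) (linForm (a l))) =
          algebraMap K (RatU K s) (∑ j, u j * a l j) := by
        simp only [D, derivation_sum_apply, Derivation.smul_apply, map_sum,
          ratPartial_algebraMap, pderiv_linForm]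
        refine Finset.sum_congr rfl fun j _ => ?_
        rw [map_mul, Algebra.smul_def, ← algebraMap_eq, ← IsScalarTower.algebraMap_apply]
      rw [h2, h1]
      split_ifs <;> simp
    set x := algebraMap _ (RatU K s) (linForm (a i)) with hx
    have hx0 : x ≠ 0 := algebraMap_linForm_ne_zero (hb.ne_zero i hi)
    have hDx : D x = 1 := by rw [hDa i hi, if_pos rfl]
    set R := ∏ l ∈ Finset.univ.erase i, algebraMap _ (RatU K s) (linForm (a l)) ^ m' l with hR
    have hDR : D R = 0 := by
      refine derivation_prod_eq_zero D _ _ fun l hl => ?_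
      by_cases hlb : l ∈ b
      · rw [Derivation.leibniz_pow, hDa l hlb, if_neg (Finset.ne_of_mem_erase hl)]
        simp
      · have : m' l = 0 := by by_contra h; exact hlb ((hm'b l).1 h)
        rw [this, pow_zero, Derivation.map_one_eq_zero]
    have hR0 : R ≠ 0 := by
      refine Finset.prod_ne_zero_iff.2 fun l _ => ?_
      by_cases hlb : l ∈ b
      · exact pow_ne_zero _ (algebraMap_linForm_ne_zero (hb.ne_zero l hlb))
      · have : m' l = 0 := by by_contra h; exact hlb ((hm'b l).1 h)
        rw [this, pow_zero]
        exact one_ne_zero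
    have hG : invPow a m' = (x ^ m' i)⁻¹ * R⁻¹ := by
      rw [invPow, ← Finset.mul_prod_erase _ _ (Finset.mem_univ i), mul_inv]
    have hDG : D (invPow a m') = -(m' i : RatU K s) * invPow a m := by
      have hm0 : m' i ≠ 0 := (hm'b i).2 hi
      rw [hmm, invPow_single_mul, hG, Derivation.leibniz, Derivation.leibniz_inv, Derivation.leibniz_inv, hDR,
        Derivation.leibniz_pow, hDx, ← hx]
      obtain ⟨k, hk⟩ := Nat.exists_eq_succ_of_ne_zero hm0
      rw [hk]
      simp only [smul_eq_mul, nsmul_eq_mul, Nat.succ_eq_add_one, Nat.add_sub_cancel]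
      field_simp
      ring
    have hmi0 : (m' i : K) ≠ 0 := by exact_mod_cast (hm'b i).2 hi
    refine ⟨(-(m' i : K)⁻¹) • (linForm u * p), ?_, ?_⟩
    · refine Submodule.smul_mem (homogeneousSubmodule (Fin s) K (n + 1)) _ ?_
      rw [add_comm]
      exact (linForm_isHomogeneous u).mul hp
    · rw [map_smul, map_mul, LinearMap.smul_apply, Module.End.mul_apply, ← hpm, ← hD, hDG,
        Algebra.smul_def, map_neg, map_inv₀, map_natCast]
      have : (m' i : RatU K s) ≠ 0 := by
        rw [← map_natCast (algebraMap K (RatU K s))]; simpa using (hm'b i).2 hi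
      field_simp

/-- If no a_i is a combination of later vectors of the denominator, these vectors form a no broken
basis. Otherwise such a relation trades one factor a_l for a_i with i < l. The total order of the
poles is kept and ∑ m_i · i decreases. -/
theorem invPow_mem_polarSpan [CharZero K] {a : Fin N → Fin s → K} (ha : ∀ i, a i ≠ 0)
    (m : Fin N → ℕ) (hm : Submodule.span K (a '' {i | m i ≠ 0}) = ⊤) {n : ℕ}
    (hn : ∑ i, m i = n + s) : invPow a m ∈ polarSpan a n := by
  classical
  induction hk : ∑ i, m i * (i : ℕ) using Nat.strong_induction_on generalizing m with
  | _ k ih =>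
  set b : Finset (Fin N) := Finset.univ.filter fun i => m i ≠ 0 with hb
  have hbm : (b : Set (Fin N)) = {i | m i ≠ 0} := by ext; simp [b]
  rw [← hbm] at hm
  by_cases h : ∀ i, a i ∉ Submodule.span K
      (a '' ((b.filter (i < ·) : Finset (Fin N)) : Set (Fin N)))
  · have hnb := isNoBroken_of_forall_notMem hm h
    obtain ⟨p, hp, hpm⟩ := exists_ratDiffHom_eq_invPow hnb.1 n m (by simp [b]) hn
    refine ⟨Pi.single ⟨b, hnb⟩ p, fun c => ?_, ?_⟩
    · by_cases hc : c = ⟨b, hnb⟩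
      · subst hc; simpa using hp
      · rw [Pi.single_eq_of_ne hc]; exact isHomogeneous_zero _ _ _
    · rw [hpm, Finset.sum_eq_single ⟨b, hnb⟩]
      · simp
      · intro c _ hc
        rw [Pi.single_eq_of_ne hc]; simp
      · simp
  push Not at h
  obtain ⟨i, hi⟩ := h
  rw [Submodule.mem_span_image_finset_iff_exists_fun'] at hi
  obtain ⟨c, hc⟩ := hi
  -- The fraction is multiplied by a_i / a_i, and the numerator is expanded by the relation; a_i
  -- need not divide the original denominator.
  have h1 : invPow a m = ∑ l ∈ b.filter (i < ·), c l • (algebraMap _ (RatU K s) (linForm (a l)) *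
      invPow a (m + Pi.single i 1)) := by
    have hx := algebraMap_linForm_ne_zero (ha i)
    have h0 := (mul_inv_cancel_left₀ hx (invPow a m)).symm
    have hxs : algebraMap _ (RatU K s) (linForm (a i)) =
        ∑ l ∈ b.filter (i < ·), c l • algebraMap _ (RatU K s) (linForm (a l)) := by
      rw [← linFormL_apply, ← hc, map_sum, map_sum]
      refine Finset.sum_congr rfl fun l _ => ?_
      rw [map_smul, linFormL_apply, Algebra.smul_def, Algebra.smul_def, map_mul,
        ← IsScalarTower.algebraMap_apply]
    rw [invPow_single_mul]
    generalize (algebraMap _ (RatU K s) (linForm (a i)))⁻¹ * invPow a m = P at h0 ⊢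
    rw [h0, hxs, Finset.sum_mul]
    exact Finset.sum_congr rfl fun l _ => smul_mul_assoc _ _ _
  rw [h1]
  refine Submodule.sum_mem _ fun l hl => ?_
  by_cases hcl : c l = 0
  · rw [hcl, zero_smul]; exact zero_mem _
  refine Submodule.smul_mem _ _ ?_
  obtain ⟨hlb, hil⟩ := Finset.mem_filter.1 hl
  have hml : m l ≠ 0 := (Finset.mem_filter.1 hlb).2
  set m₀ : Fin N → ℕ := m - Pi.single l 1 with hm₀
  have hmm : m = m₀ + Pi.single l 1 := by
    ext j
    by_cases hj : j = l
    · subst hj; simp [m₀]; omega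
    · simp [m₀, hj]
  have h2 : algebraMap _ (RatU K s) (linForm (a l)) * invPow a (m + Pi.single i 1) =
      invPow a (m₀ + Pi.single i 1) := by
    rw [hmm, add_right_comm, invPow_single_mul _ l, mul_inv_cancel_left₀
      (algebraMap_linForm_ne_zero (ha l))]
  rw [h2]
  have hsupp (j : Fin N) (hj : j ∈ b) (hjl : j ≠ l) : (m₀ + Pi.single i 1 : Fin N → ℕ) j ≠ 0 := by
    have := (Finset.mem_filter.1 hj).2
    simp [m₀, hjl, this]
  refine ih _ ?_ _ ?_ ?_ rfl
  · rw [← hk, hmm]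
    simp only [Pi.add_apply, add_mul, Finset.sum_add_distrib]
    refine Nat.add_lt_add_left ?_ _
    simpa [Pi.single_apply, ite_mul] using hil
  -- The factor a_l may disappear from the denominator, but as its coefficient in the relation is
  -- nonzero, it is recovered from a_i and the other vectors.
  · rw [eq_top_iff, ← hm, Submodule.span_le]
    set W := Submodule.span K (a '' {j | (m₀ + Pi.single i 1 : Fin N → ℕ) j ≠ 0})
    have hW (j : Fin N) (hj : j ∈ b) (hjl : j ≠ l) : a j ∈ W :=
      Submodule.subset_span ⟨j, hsupp j hj hjl, rfl⟩
    have hWi : a i ∈ W := Submodule.subset_span ⟨i, by simp, rfl⟩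
    rintro _ ⟨j, hj, rfl⟩
    by_cases hjl : j = l
    · subst hjl
      rw [← Finset.add_sum_erase _ _ hl] at hc
      rw [← inv_smul_smul₀ hcl (a j), eq_sub_of_add_eq hc]
      refine W.smul_mem _ (W.sub_mem hWi (W.sum_mem fun e he => W.smul_mem _ (hW e ?_ ?_)))
      · exact (Finset.mem_filter.1 (Finset.mem_of_mem_erase he)).1
      · exact Finset.ne_of_mem_erase he
    · exact hW j hj hjl
  · rw [← hn, hmm]
    simp [Finset.sum_add_distrib]

end Existence

/-! ### The polynomials p_b: uniqueness, duality and membership in D(X). -/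

section PolarFamily

variable {K : Type*} [Field K] {s N : ℕ}

theorem reflect_eq {p : MvPolynomial (Fin s) K} {n : ℕ} (hp : p.IsHomogeneous n) :
    reflect p = (-1 : K) ^ n • p := by
  rw [reflect]
  conv_lhs => rw [p.as_sum]
  conv_rhs => rw [p.as_sum]
  rw [map_sum, Finset.smul_sum]
  refine Finset.sum_congr rfl fun m hm => ?_
  have hn : m.degree = n := by
    have := hp (mem_support_iff.1 hm)
    rwa [Finsupp.degree_eq_weight_one]
  rw [aeval_monomial, monomial_eq, ← hn, Finsupp.degree_eq_sum, Finsupp.prod_fintype _ _ (by simp),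
    Finsupp.prod_fintype _ _ (by simp), algebraMap_eq, smul_eq_C_mul]
  simp only [neg_pow (X _ : MvPolynomial (Fin s) K), Finset.prod_mul_distrib, Finset.prod_pow_eq_pow_sum]
  simp only [map_pow, map_neg, map_one]
  ring

theorem invPow_one (a : Fin N → Fin s → K) : invPow a 1 = invProd a Finset.univ := by
  simp [invPow, invProd, listProd]

variable {a : Fin N → Fin s → K}

theorem card_compl_noBroken (b : NB a) : (b.1)ᶜ.card = N - s := by
  rw [Finset.card_compl, b.2.1.card_eq, Fintype.card_fin]

/-- The defining identity is multiplied by ∏_{i∈Y} a_i. This cancels in 1/∏_{a∈X} a and, modulo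
lower poles, acts on each p_b as a differential operator. -/
theorem IsPolarFamily.sum_sub_mem {p : NB a → MvPolynomial (Fin s) K} (hp : IsPolarFamily a p)
    (ha : ∀ i, a i ≠ 0) (Y : Finset (Fin N)) :
    invProd a Yᶜ - ∑ b, ratDiffHom (diffHom (reflect (listProd a Y)) (p b)) (invProd a b.1) ∈
      lowerPoles K s := by
  have h1 := sum_mem (t := Finset.univ) fun b _ =>
    mul_ratDiffHom_sub_mem (X_mul_invProd_mem (b := b.1) b.2.1) (listProd a Y) (p b)
  convert h1 using 1
  rw [Finset.sum_sub_distrib, ← Finset.mul_sum]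
  congr 1
  have h2 := hp.2
  simp only [ratDiffOp_eq] at h2
  rw [← h2, ← Finset.union_compl Y, listProd_mul_invProd (fun i _ => ha i) disjoint_compl_right]

/-- Polynomial and operator have the same degree N - s, so reflecting either one produces the same
sign. -/
theorem DOp_reflect {p : MvPolynomial (Fin s) K} (hp : p.IsHomogeneous (N - s)) (b : NB a) :
    DOp a (b.1)ᶜ (reflect p) = diffHom (reflect (listProd a (b.1)ᶜ)) p := by
  rw [DOp, diffOp_eq, reflect_eq hp, reflect_eq (listProd_isHomogeneous a _),
    card_compl_noBroken, map_smul, map_smul, LinearMap.smul_apply]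

/-- For Y = X∖b the multiplied identity expresses 1/∏_{a∈b} a by the classes of all no broken bases
with constant coefficients; independence compares them. -/
theorem IsPolarFamily.DOp_reflect_eq {p : NB a → MvPolynomial (Fin s) K} (hp : IsPolarFamily a p)
    (ha : ∀ i, a i ≠ 0) (b c : NB a) :
    DOp a (b.1)ᶜ (reflect (p c)) = if b = c then 1 else 0 := by
  rw [DOp_reflect (hp.1 c)]
  have h1 (c : NB a) : (diffHom (reflect (listProd a (b.1)ᶜ)) (p c)).IsHomogeneous 0 := by
    rw [reflect_eq (listProd_isHomogeneous a _), map_smul, LinearMap.smul_apply]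
    refine Submodule.smul_mem (homogeneousSubmodule (Fin s) K 0) _ ?_
    refine diffHom_isHomogeneous (listProd_isHomogeneous a _) ?_
    rw [card_compl_noBroken, zero_add]
    exact hp.1 c
  have h2 := hp.sum_sub_mem ha (b.1)ᶜ
  rw [compl_compl] at h2
  have h3 := coeff_eq_zero_of_sum_invProd_mem (a := a) (l := fun c => (if b = c then 1 else 0) -
    coeff 0 (diffHom (reflect (listProd a (b.1)ᶜ)) (p c))) ?_ c
  · rw [eq_C_of_isHomogeneous (h1 c), ← sub_eq_zero.1 h3]
    split_ifs <;> simp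
  · convert h2 using 1
    simp only [sub_smul, Finset.sum_sub_distrib, ite_smul, one_smul, zero_smul,
      Finset.sum_ite_eq, Finset.mem_univ, if_true]
    congr 1
    refine Finset.sum_congr rfl fun c _ => ?_
    conv_rhs => rw [eq_C_of_isHomogeneous (h1 c), ratDiffHom_C]

theorem IsPolarFamily.linearIndependent {p : NB a → MvPolynomial (Fin s) K}
    (hp : IsPolarFamily a p) (ha : ∀ i, a i ≠ 0) : LinearIndependent K p := by
  rw [Fintype.linearIndependent_iff]
  intro g hg b
  have h : ∑ c, g c • DOp a (b.1)ᶜ (reflect (p c)) = 0 := by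
    have := congrArg (fun q => DOp a (b.1)ᶜ (reflect q)) hg
    simpa only [reflect, map_sum, map_smul, map_zero] using this
  simp only [hp.DOp_reflect_eq ha b] at h
  simpa [smul_eq_C_mul] using h

variable [CharZero K]

theorem exists_isPolarFamily (ha : ∀ i, a i ≠ 0) (hs : Submodule.span K (Set.range a) = ⊤) :
    ∃ p, IsPolarFamily a p := by
  have hsN : s ≤ N := by
    have := card_ge_of_span_eq_top (a := a) (b := Finset.univ) (by simpa using hs)
    simpa using this
  obtain ⟨p, hp, h⟩ := invPow_mem_polarSpan ha 1 (by simpa using hs) (n := N - s) (by simp; omega)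
  refine ⟨p, hp, ?_⟩
  rw [← invPow_one, h]
  simp only [ratDiffOp_eq]

theorem IsPolarFamily.unique {p q : NB a → MvPolynomial (Fin s) K} (hp : IsPolarFamily a p)
    (hq : IsPolarFamily a q) : p = q := by
  ext1 b
  refine sub_eq_zero.1 (eq_zero_of_sum_ratDiffHom_mem (n := N - s) (p := fun b => p b - q b)
    (fun b => (hp.1 b).sub (hq.1 b)) ?_ b)
  have h := hp.2.symm.trans hq.2
  simp only [ratDiffOp_eq] at h
  simp only [map_sub, LinearMap.sub_apply, Finset.sum_sub_distrib]
  rw [h, sub_self]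
  exact zero_mem _

/-- For a cocircuit Y the left side of the multiplied identity is itself a lower pole, so
independence gives D_Y p_b = 0. If Y has more than N - s elements, the degree alone suffices. -/
theorem IsPolarFamily.mem_DXdeg {p : NB a → MvPolynomial (Fin s) K} (hp : IsPolarFamily a p)
    (ha : ∀ i, a i ≠ 0) (b : NB a) : p b ∈ DXdeg a (N - s) := by
  refine ⟨?_, hp.1 b⟩
  simp only [DX, Submodule.mem_iInf, SetLike.mem_coe, LinearMap.mem_ker]
  intro Y hY
  rw [DOp, diffOp_eq]
  rcases lt_or_ge (N - s) Y.card with h | h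
  · exact diffHom_listProd_eq_zero a (hp.1 b) h
  have h1 : invProd a Yᶜ ∈ lowerPoles K s := invProd_mem_lowerPoles (by
    rw [show ((Yᶜ : Finset (Fin N)) : Set (Fin N)) = {i | i ∉ Y} by ext; simp]
    exact hY)
  have h2 := sub_mem h1 (hp.sum_sub_mem ha Y)
  rw [sub_sub_cancel, reflect_eq (listProd_isHomogeneous a Y)] at h2
  have h3 (b : NB a) : (diffHom (listProd a Y) (p b)).IsHomogeneous (N - s - Y.card) :=
    diffHom_isHomogeneous (listProd_isHomogeneous a Y) (by rw [Nat.sub_add_cancel h]; exact hp.1 b)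
  have h4 := eq_zero_of_sum_ratDiffHom_mem (n := N - s - Y.card) (fun b => ?_) h2 b
  · rw [map_smul, LinearMap.smul_apply] at h4
    exact (smul_eq_zero.1 h4).resolve_left (by simp)
  · rw [map_smul, LinearMap.smul_apply]
    exact Submodule.smul_mem (homogeneousSubmodule (Fin s) K _) _ (h3 b)

theorem eq_of_mem_DXdeg (hs : Submodule.span K (Set.range a) = ⊤) {p q : MvPolynomial (Fin s) K}
    (hp : p ∈ DXdeg a (N - s)) (hq : q ∈ DXdeg a (N - s))
    (h : ∀ b : NB a, DOp a (b.1)ᶜ p = DOp a (b.1)ᶜ q) : p = q := by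
  refine sub_eq_zero.1 (eq_zero_of_mem_DXdeg hs (sub_mem hp hq) fun b => ?_)
  rw [← diffOp_eq, map_sub]
  exact sub_eq_zero.2 (h b)

theorem polarFamily_spec (ha : ∀ i, a i ≠ 0) (hs : Submodule.span K (Set.range a) = ⊤) :
    (∃! p : NB a → MvPolynomial (Fin s) K, IsPolarFamily a p) ∧
      ∀ p : NB a → MvPolynomial (Fin s) K, IsPolarFamily a p →
        (∀ b, p b ∈ DXdeg a (N - s)) ∧
        (∀ b c : NB a, DOp a (b.1)ᶜ (reflect (p c)) = if b = c then 1 else 0) ∧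
        LinearIndependent K p ∧
        (∀ c : NB a, ∀ q ∈ DXdeg a (N - s),
          (∀ b : NB a, DOp a (b.1)ᶜ (reflect q) = if b = c then 1 else 0) → q = p c) := by
  obtain ⟨p₀, hp₀⟩ := exists_isPolarFamily ha hs
  refine ⟨⟨p₀, hp₀, fun q hq => IsPolarFamily.unique hq hp₀⟩, fun p hp =>
    ⟨hp.mem_DXdeg ha, hp.DOp_reflect_eq ha, hp.linearIndependent ha, fun c q hq h => ?_⟩⟩
  refine eq_of_mem_DXdeg hs hq (hp.mem_DXdeg ha c) fun b => ?_
  have h1 := (h b).trans (hp.DOp_reflect_eq ha b c).symm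
  rw [reflect_eq hq.2, reflect_eq (hp.1 c), map_smul, map_smul] at h1
  exact (smul_right_injective _ (by simp)) h1

end PolarFamily

/-! ### Integration along rays as the inverse of -D_v. -/

section RayIntegral

open Filter Topology Set
open scoped ContDiff

variable {V : Type} [NormedAddCommGroup V] [NormedSpace ℝ V]
  {E : Type} [NormedAddCommGroup E]

variable {y : V →L[ℝ] ℝ} {v : V} {f : V → E} {R : ℝ}

theorem eq_zero_along_ray (hf : ∀ x, R < y x → f x = 0) {x : V} {C t : ℝ} (hx : R - C < y x)
    (ht : C / y v ≤ t) (hv : 0 < y v) : f (x + t • v) = 0 := by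
  apply hf
  rw [div_le_iff₀ hv] at ht
  rw [map_add, map_smul, smul_eq_mul]
  linarith

theorem integrableOn_ray (hv : 0 < y v) (hc : Continuous f) (hf : ∀ x, R < y x → f x = 0) (x : V) :
    IntegrableOn (fun t : ℝ => f (x + t • v)) (Ioi 0) := by
  set T := (R - y x + 1) / y v with hT
  have h1 : IntegrableOn (fun t : ℝ => f (x + t • v)) (Icc 0 T) :=
    (Continuous.continuousOn (by fun_prop)).integrableOn_Icc
  have h2 : IntegrableOn (fun t : ℝ => f (x + t • v)) (Ici T) :=
    integrableOn_zero.congr_fun (fun t ht => (eq_zero_along_ray hf (by linarith) ht hv).symm)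
      measurableSet_Ici
  refine (h1.union h2).mono_set fun t ht => ?_
  rcases le_total t T with h | h
  · exact Or.inl ⟨ht.le, h⟩
  · exact Or.inr h

variable [NormedSpace ℝ E]

/-- The integral of a function along the rays with direction `v`. -/
noncomputable def rayIntegral (v : V) (f : V → E) (x : V) : E := ∫ t in Ioi (0 : ℝ), f (x + t • v)

theorem fderiv_eq_zero_of_lt (hf : ∀ x, R < y x → f x = 0) (x : V) (hx : R < y x) :
    fderiv ℝ f x = 0 := by
  have h : f =ᶠ[𝓝 x] fun _ => 0 := by
    filter_upwards [(isOpen_lt continuous_const y.continuous).mem_nhds hx] with z hz using hf z hz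
  rw [h.fderiv_eq, fderiv_fun_const]
  rfl

theorem hasFDerivAt_rayIntegral [ProperSpace V] (hv : 0 < y v) (hc : ContDiff ℝ ∞ f)
    (hf : ∀ x, R < y x → f x = 0) (x₀ : V) :
    HasFDerivAt (rayIntegral v f) (rayIntegral v (fderiv ℝ f) x₀) x₀ := by
  have hf' := fderiv_eq_zero_of_lt hf
  have hc' : Continuous (fderiv ℝ f) := hc.continuous_fderiv (by simp)
  -- A lower bound m of y on the ball gives one time T after which f vanishes along every ray
  -- starting in the ball, hence an integrable bound with compact support.
  obtain ⟨m, hm⟩ : ∃ m, ∀ x ∈ Metric.ball x₀ 1, m < y x := by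
    obtain ⟨m, hm⟩ := ((isCompact_closedBall x₀ 1).image y.continuous).bddBelow
    exact ⟨m - 1, fun x hx => by
      linarith [hm ⟨x, Metric.ball_subset_closedBall hx, rfl⟩]⟩
  set T := (R - m) / y v with hT
  have hcomp : IsCompact ((fun p : V × ℝ => p.1 + p.2 • v) ''
      (Metric.closedBall x₀ 1 ×ˢ Icc 0 T)) :=
    ((isCompact_closedBall x₀ 1).prod isCompact_Icc).image (by fun_prop)
  obtain ⟨C, hC⟩ := hcomp.exists_bound_of_continuousOn hc'.continuousOn
  refine hasFDerivAt_integral_of_dominated_of_fderiv_le (F := fun x t => f (x + t • v))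
    (F' := fun x t => fderiv ℝ f (x + t • v)) (bound := indicator (Icc 0 T) fun _ => C)
    (Metric.ball_mem_nhds x₀ one_pos) ?_ ?_ ?_ ?_ ?_ ?_
  · refine Eventually.of_forall fun x => Continuous.aestronglyMeasurable ?_
    have := hc.continuous
    fun_prop
  · exact integrableOn_ray hv hc.continuous hf x₀
  · have : SecondCountableTopologyEither ℝ (V →L[ℝ] E) := secondCountableTopologyEither_of_left _ _
    exact (show Continuous fun t : ℝ => fderiv ℝ f (x₀ + t • v) by fun_prop).aestronglyMeasurable
  · refine (ae_restrict_iff' measurableSet_Ioi).2 (Eventually.of_forall fun t ht x hx => ?_)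
    by_cases htT : t ≤ T
    · rw [indicator_of_mem (show t ∈ Icc 0 T from ⟨le_of_lt ht, htT⟩)]
      have hxt : (x, t) ∈ Metric.closedBall x₀ 1 ×ˢ Icc 0 T :=
        ⟨Metric.ball_subset_closedBall hx, le_of_lt ht, htT⟩
      exact hC _ (mem_image_of_mem _ hxt)
    · rw [indicator_of_notMem fun h => htT h.2,
        eq_zero_along_ray (C := R - m) hf' (by linarith [hm x hx]) (not_le.1 htT).le hv, norm_zero]
  · refine Integrable.mono_measure ?_ Measure.restrict_le_self
    exact (integrable_indicator_iff measurableSet_Icc).2 (by simp)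
  · refine Eventually.of_forall fun t x _ => ?_
    have h1 : HasFDerivAt f (fderiv ℝ f (x + t • v)) (x + t • v) :=
      (hc.differentiable (by simp) _).hasFDerivAt
    simpa [Function.comp_def] using h1.comp x ((hasFDerivAt_id x).add_const (t • v))

/-- The derivative of a ray integral is the ray integral of the derivative. The induction has to
vary the target E, since the derivative is operator valued. -/
theorem contDiff_rayIntegral [ProperSpace V] (hv : 0 < y v) (hc : ContDiff ℝ ∞ f)
    (hf : ∀ x, R < y x → f x = 0) : ContDiff ℝ ∞ (rayIntegral v f) := by
  rw [contDiff_infty]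
  intro n
  induction n generalizing E with
  | zero =>
    rw [Nat.cast_zero, contDiff_zero]
    exact continuous_iff_continuousAt.2 fun x =>
      (hasFDerivAt_rayIntegral hv hc hf x).continuousAt
  | succ n ih =>
    rw [Nat.cast_succ, contDiff_succ_iff_fderiv]
    refine ⟨fun x => (hasFDerivAt_rayIntegral hv hc hf x).differentiableAt, by simp, ?_⟩
    have h1 : fderiv ℝ (rayIntegral v f) = rayIntegral v (fderiv ℝ f) :=
      funext fun x => (hasFDerivAt_rayIntegral hv hc hf x).fderiv
    rw [h1]
    exact ih (hc.fderiv_right (by simp)) (fderiv_eq_zero_of_lt hf)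

/-- By the fundamental theorem of calculus only the endpoint t = 0 contributes, because f vanishes
far along the ray. -/
theorem rayIntegral_fderiv [CompleteSpace E] (hv : 0 < y v) (hc : ContDiff ℝ ∞ f)
    (hf : ∀ x, R < y x → f x = 0) (x : V) :
    rayIntegral v (fun z => fderiv ℝ f z v) x = -f x := by
  have h1 : ∀ t ∈ Ici (0 : ℝ), HasDerivAt (fun t : ℝ => f (x + t • v))
      (fderiv ℝ f (x + t • v) v) t := by
    intro t _
    have h2 : HasFDerivAt f (fderiv ℝ f (x + t • v)) (x + t • v) :=
      (hc.differentiable (by simp) _).hasFDerivAt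
    have h3 : HasDerivAt (fun t : ℝ => x + t • v) v t := by
      simpa using ((hasDerivAt_id t).smul_const v).const_add x
    exact h2.comp_hasDerivAt t h3
  have h2 := integral_Ioi_of_hasDerivAt_of_tendsto' (m := 0) h1
    (integrableOn_ray (f := fun z => fderiv ℝ f z v) (R := R) hv
      ((hc.continuous_fderiv (by simp)).clm_apply continuous_const)
      (fun z hz => by rw [fderiv_eq_zero_of_lt hf z hz]; rfl) x) ?_
  · simpa [rayIntegral] using h2
  · refine tendsto_const_nhds.congr' ?_
    filter_upwards [eventually_ge_atTop ((R - y x + 1) / y v)] with t ht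
    exact (eq_zero_along_ray hf (by linarith) ht hv).symm

theorem fderiv_rayIntegral [ProperSpace V] [CompleteSpace E] (hv : 0 < y v) (hc : ContDiff ℝ ∞ f)
    (hf : ∀ x, R < y x → f x = 0) (x : V) :
    fderiv ℝ (rayIntegral v f) x v = -f x := by
  rw [(hasFDerivAt_rayIntegral hv hc hf x).fderiv, ← rayIntegral_fderiv hv hc hf x, rayIntegral,
    rayIntegral, ← ContinuousLinearMap.integral_apply]
  exact integrableOn_ray hv (hc.continuous_fderiv (by simp)) (fderiv_eq_zero_of_lt hf) x

theorem rayIntegral_eq_zero (hv : 0 < y v) (hf : ∀ x, R < y x → f x = 0) (x : V) (hx : R < y x) :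
    rayIntegral v f x = 0 := by
  refine setIntegral_eq_zero_of_forall_eq_zero fun t ht => hf _ ?_
  rw [map_add, map_smul, smul_eq_mul]
  have := mul_pos (Set.mem_Ioi.1 ht) hv
  linarith

end RayIntegral

/-! ### Rational functions acting as operators. -/

section Represents

variable {K : Type*} [Field K] {s N : ℕ} {E : Type*} [AddCommGroup E] [Module K E]
  (ρ : MvPolynomial (Fin s) K →ₐ[K] Module.End K E)

/-- The operator `A` is the action of the rational function `r` in the representation `ρ` of
`S[V]`. -/
def Represents (r : RatU K s) (A : Module.End K E) : Prop :=
  ∃ P Q : MvPolynomial (Fin s) K, Q ≠ 0 ∧ IsUnit (ρ Q) ∧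
    algebraMap _ (RatU K s) Q * r = algebraMap _ (RatU K s) P ∧ ρ Q * A = ρ P

variable {ρ} {r r' : RatU K s} {A A' : Module.End K E}

theorem commute_apply (P Q : MvPolynomial (Fin s) K) : ρ P * ρ Q = ρ Q * ρ P := by
  rw [← map_mul, mul_comm, map_mul]

/-- By cross-multiplication A and A' agree after composition with the invertible operator ρ(Q)
ρ(Q'). -/
theorem Represents.unique (h : Represents ρ r A) (h' : Represents ρ r A') : A = A' := by
  obtain ⟨P, Q, hQ0, hQ, hr, hA⟩ := h
  obtain ⟨P', Q', hQ0', hQ', hr', hA'⟩ := h'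
  have h1 : P * Q' = P' * Q := by
    apply IsFractionRing.injective (MvPolynomial (Fin s) K) (RatU K s)
    rw [map_mul, map_mul, ← hr, ← hr']
    ring
  refine (hQ.mul hQ').mul_left_cancel ?_
  rw [commute_apply Q Q', mul_assoc, hA, commute_apply Q' Q, mul_assoc, hA', ← map_mul, ← map_mul,
    mul_comm Q', h1, mul_comm P']

theorem Represents.zero : Represents ρ 0 0 := ⟨0, 1, one_ne_zero, by simp, by simp, by simp⟩

theorem Represents.add (h : Represents ρ r A) (h' : Represents ρ r' A') :
    Represents ρ (r + r') (A + A') := by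
  obtain ⟨P, Q, hQ0, hQ, hr, hA⟩ := h
  obtain ⟨P', Q', hQ0', hQ', hr', hA'⟩ := h'
  refine ⟨Q' * P + Q * P', Q * Q', mul_ne_zero hQ0 hQ0', ?_, ?_, ?_⟩
  · rw [map_mul]; exact hQ.mul hQ'
  · simp only [map_mul, map_add, ← hr, ← hr']; ring
  · simp only [map_mul, map_add, ← hA, ← hA', mul_add]
    rw [commute_apply Q Q', mul_assoc, commute_apply Q' Q, mul_assoc]

theorem Represents.sum {κ : Type*} (T : Finset κ) {r : κ → RatU K s} {A : κ → Module.End K E}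
    (h : ∀ i ∈ T, Represents ρ (r i) (A i)) : Represents ρ (∑ i ∈ T, r i) (∑ i ∈ T, A i) := by
  induction T using Finset.cons_induction with
  | empty => simpa using Represents.zero
  | cons i T hi ih =>
    rw [Finset.sum_cons, Finset.sum_cons]
    exact (h i (Finset.mem_cons_self i T)).add (ih fun j hj => h j (Finset.mem_cons_of_mem hj))

theorem Represents.smul (c : K) (h : Represents ρ r A) : Represents ρ (c • r) (c • A) := by
  obtain ⟨P, Q, hQ0, hQ, hr, hA⟩ := h
  refine ⟨c • P, Q, hQ0, hQ, ?_, ?_⟩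
  · rw [mul_smul_comm, hr, Algebra.smul_def, Algebra.smul_def, map_mul,
      ← IsScalarTower.algebraMap_apply]
  · rw [mul_smul_comm, hA, map_smul]

variable {M : Fin s → Module.End K E}

/-- Taking the commutator with M_j is a derivation that extends ∂_j from polynomials; the quotient
rule then determines it on fractions. -/
theorem Represents.ratPartial (hM : ∀ P j, ρ P * M j - M j * ρ P = -ρ (pderiv j P))
    (h : Represents ρ r A) (j : Fin s) :
    Represents ρ (ratPartial j r) (M j * A - A * M j) := by
  obtain ⟨P, Q, hQ0, hQ, hr, hA⟩ := h
  have hM' (P : MvPolynomial (Fin s) K) : ρ P * M j = M j * ρ P - ρ (pderiv j P) := by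
    rw [sub_eq_add_neg, ← hM, add_sub_cancel]
  refine ⟨Q * pderiv j P - P * pderiv j Q, Q * Q, mul_ne_zero hQ0 hQ0, ?_, ?_, ?_⟩
  · rw [map_mul]; exact hQ.mul hQ
  · have h1 := congrArg (Spline.ratPartial j) hr
    rw [Derivation.leibniz, ratPartial_algebraMap, ratPartial_algebraMap, smul_eq_mul,
      smul_eq_mul] at h1
    simp only [map_mul, map_sub]
    rw [← h1, ← hr]
    ring
  · have h1 : ρ Q * (M j * A - A * M j) = ρ (pderiv j P) - ρ (pderiv j Q) * A := by
      rw [mul_sub, ← mul_assoc, ← mul_assoc, hM' Q, hA, hM' P, sub_mul, mul_assoc, hA]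
      abel
    rw [map_mul, mul_assoc, h1, mul_sub, map_sub, map_mul, map_mul, ← mul_assoc,
      commute_apply Q (pderiv j Q), mul_assoc, hA, commute_apply P]

/-- As ε kills the image of M_j, the commutator [M_j, A] is seen by ε as A composed with -M_j.
Iterating, p(∂) on the rational function becomes p(-M) on the argument. -/
theorem Represents.exists_ratDiffHom (hM : ∀ P j, ρ P * M j - M j * ρ P = -ρ (pderiv j P))
    (μ : MvPolynomial (Fin s) K →ₐ[K] Module.End K E) (hμ : ∀ j, μ (X j) = -M j)
    (ε : E →ₗ[K] K) (hε : ∀ j f, ε (M j f) = 0) (p : MvPolynomial (Fin s) K)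
    (h : Represents ρ r A) :
    ∃ A', Represents ρ (ratDiffHom p r) A' ∧ ∀ f, ε (A' f) = ε (A (μ p f)) := by
  induction p using MvPolynomial.induction_on generalizing r A with
  | C c =>
    refine ⟨c • A, ?_, fun f => ?_⟩
    · rw [ratDiffHom_C]; exact h.smul c
    · rw [← algebraMap_eq, AlgHom.commutes]
      simp [Module.algebraMap_end_apply]
  | add p q hp hq =>
    obtain ⟨A₁, h₁, e₁⟩ := hp h
    obtain ⟨A₂, h₂, e₂⟩ := hq h
    exact ⟨A₁ + A₂, by rw [map_add]; exact h₁.add h₂, fun f => by simp [e₁, e₂]⟩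
  | mul_X p j hp =>
    obtain ⟨A', h', e'⟩ := hp (h.ratPartial hM j)
    refine ⟨A', ?_, fun f => ?_⟩
    · rw [map_mul, Module.End.mul_apply, ratDiffHom_X]; exact h'
    · rw [e', mul_comm, map_mul, hμ]
      simp [hε]

theorem prod_mul_prod_eq_one {n : ℕ} (z : Fin n → Fin s → K) (I : Fin n → Module.End K E)
    (h : ∀ k, ρ (linForm (z k)) * I k = 1) :
    ρ (∏ k, linForm (z k)) * (List.ofFn I).prod = 1 := by
  induction n with
  | zero => simp
  | succ n ih =>
    rw [Fin.prod_univ_succ, List.ofFn_succ, List.prod_cons, mul_comm, map_mul, mul_assoc,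
      ← mul_assoc (ρ _) (I 0), h 0, one_mul]
    exact ih (fun k => z k.succ) (fun k => I k.succ) fun k => h k.succ

theorem represents_inv_prod {n : ℕ} (z : Fin n → Fin s → K) (hz : ∀ k, z k ≠ 0)
    (I : Fin n → Module.End K E) (h : ∀ k, ρ (linForm (z k)) * I k = 1)
    (h' : ∀ k, I k * ρ (linForm (z k)) = 1) :
    Represents ρ (algebraMap _ (RatU K s) (∏ k, linForm (z k)))⁻¹ (List.ofFn I).prod := by
  have h0 : ∏ k, linForm (z k) ≠ 0 := Finset.prod_ne_zero_iff.2 fun k _ => linForm_ne_zero (hz k)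
  refine ⟨1, ∏ k, linForm (z k), h0, ?_, ?_, ?_⟩
  · refine Finset.prod_induction (fun k => linForm (z k)) (fun q => IsUnit (ρ q))
      (fun p q hp hq => by rw [map_mul]; exact hp.mul hq) (by rw [map_one]; exact isUnit_one)
      fun k _ => ⟨⟨_, I k, h k, h' k⟩, rfl⟩
  · rw [map_one]
    exact mul_inv_cancel₀ ((map_ne_zero_iff _ (IsFractionRing.injective _ _)).2 h0)
  · rw [map_one, prod_mul_prod_eq_one z I h]

end Represents

/-! ### The representation on smooth functions vanishing on a half space. -/

section HalfSpace

open scoped ContDiff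

variable {s : ℕ}

/-- Smooth functions on `V` that vanish on some half space `{x | R < y x}`. -/
def halfSpaceSubmodule (y : (Fin s → ℝ) →L[ℝ] ℝ) : Submodule ℝ ((Fin s → ℝ) → ℝ) where
  carrier := {f | ContDiff ℝ ∞ f ∧ ∃ R, ∀ x, R < y x → f x = 0}
  zero_mem' := ⟨contDiff_const, 0, fun _ _ => rfl⟩
  add_mem' := by
    rintro f g ⟨hf, R, hR⟩ ⟨hg, R', hR'⟩
    refine ⟨hf.add hg, max R R', fun x hx => ?_⟩
    rw [Pi.add_apply, hR x ((le_max_left _ _).trans_lt hx), hR' x ((le_max_right _ _).trans_lt hx),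
      add_zero]
  smul_mem' := by
    rintro c f ⟨hf, R, hR⟩
    exact ⟨contDiff_const.smul hf, R, fun x hx => by rw [Pi.smul_apply, hR x hx, smul_zero]⟩

variable {y : (Fin s → ℝ) →L[ℝ] ℝ}

/-- The space of smooth functions on `V` that vanish on some half space `{x | R < y x}`. -/
def HalfSpaceFun (y : (Fin s → ℝ) →L[ℝ] ℝ) : Type := halfSpaceSubmodule y

noncomputable instance : AddCommGroup (HalfSpaceFun y) :=
  inferInstanceAs (AddCommGroup (halfSpaceSubmodule y))

noncomputable instance : Module ℝ (HalfSpaceFun y) :=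
  inferInstanceAs (Module ℝ (halfSpaceSubmodule y))

namespace HalfSpaceFun

theorem ext {f g : HalfSpaceFun y} (h : ∀ x, f.1 x = g.1 x) : f = g := Subtype.ext (funext h)

theorem add_apply (f g : HalfSpaceFun y) (x : Fin s → ℝ) : (f + g).1 x = f.1 x + g.1 x := rfl

theorem neg_apply (f : HalfSpaceFun y) (x : Fin s → ℝ) : (-f).1 x = -f.1 x := rfl

theorem smul_apply (c : ℝ) (f : HalfSpaceFun y) (x : Fin s → ℝ) : (c • f).1 x = c * f.1 x := rfl

theorem sum_apply {κ : Type*} (T : Finset κ) (f : κ → HalfSpaceFun y) (x : Fin s → ℝ) :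
    (∑ i ∈ T, f i).1 x = ∑ i ∈ T, (f i).1 x := by
  induction T using Finset.cons_induction with
  | empty => rfl
  | cons i T hi ih => rw [Finset.sum_cons, Finset.sum_cons, add_apply, ih]

theorem contDiff (f : HalfSpaceFun y) : ContDiff ℝ ∞ f.1 := f.2.1

theorem differentiable (f : HalfSpaceFun y) : Differentiable ℝ f.1 :=
  f.contDiff.differentiable (by simp)

end HalfSpaceFun

/-- The directional derivative on smooth functions that vanish on a half space. -/
noncomputable def dirDeriv (y : (Fin s → ℝ) →L[ℝ] ℝ) (v : Fin s → ℝ) :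
    Module.End ℝ (HalfSpaceFun y) where
  toFun f := ⟨fun x => fderiv ℝ f.1 x v, (f.contDiff.fderiv_right (by simp)).clm_apply
    contDiff_const, by
      obtain ⟨R, hR⟩ := f.2.2
      exact ⟨R, fun x hx => by
        change fderiv ℝ f.1 x v = 0
        rw [fderiv_eq_zero_of_lt hR x hx]; rfl⟩⟩
  map_add' f g := by
    refine HalfSpaceFun.ext fun x => ?_
    change fderiv ℝ (f.1 + g.1) x v = fderiv ℝ f.1 x v + fderiv ℝ g.1 x v
    rw [fderiv_add (f.differentiable x) (g.differentiable x)]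
    rfl
  map_smul' c f := by
    refine HalfSpaceFun.ext fun x => ?_
    change fderiv ℝ (c • f.1) x v = c * fderiv ℝ f.1 x v
    rw [fderiv_const_smul (f.differentiable x)]
    rfl

theorem dirDeriv_apply (v : Fin s → ℝ) (f : HalfSpaceFun y) (x : Fin s → ℝ) :
    (dirDeriv y v f).1 x = fderiv ℝ f.1 x v := rfl

theorem dirDeriv_comm (v w : Fin s → ℝ) :
    dirDeriv y v * dirDeriv y w = dirDeriv y w * dirDeriv y v := by
  have key (v w : Fin s → ℝ) (f : HalfSpaceFun y) (x : Fin s → ℝ) :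
      fderiv ℝ (fun z => fderiv ℝ f.1 z w) x v = fderiv ℝ (fderiv ℝ f.1) x v w := by
    have h : DifferentiableAt ℝ (fderiv ℝ f.1) x :=
      (f.contDiff.fderiv_right (m := ∞) (by simp)).differentiable (by simp) x
    rw [fderiv_clm_apply h (differentiableAt_const w)]
    simp
  refine LinearMap.ext fun f => HalfSpaceFun.ext fun x => ?_
  change fderiv ℝ (fun z => fderiv ℝ f.1 z w) x v = fderiv ℝ (fun z => fderiv ℝ f.1 z v) x w
  rw [key, key]
  exact (f.contDiff.contDiffAt.isSymmSndFDerivAt (by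
    simpa using WithTop.coe_le_coe.2 (le_top (a := (2 : ℕ∞))))) v w

/-- Multiplication by a coordinate function. -/
noncomputable def mulCoord (y : (Fin s → ℝ) →L[ℝ] ℝ) (j : Fin s) :
    Module.End ℝ (HalfSpaceFun y) where
  toFun f := ⟨fun x => x j * f.1 x, (contDiff_apply ℝ ℝ j).mul f.contDiff, by
      obtain ⟨R, hR⟩ := f.2.2
      exact ⟨R, fun x hx => by
        change x j * f.1 x = 0
        rw [hR x hx, mul_zero]⟩⟩
  map_add' f g := HalfSpaceFun.ext fun x => mul_add _ _ _
  map_smul' c f := HalfSpaceFun.ext fun x => mul_left_comm _ _ _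

theorem mulCoord_apply (j : Fin s) (f : HalfSpaceFun y) (x : Fin s → ℝ) :
    (mulCoord y j f).1 x = x j * f.1 x := rfl

/-- The representation of `S[V]` for which `v` acts as `-D_v`. -/
noncomputable def derivRep (y : (Fin s → ℝ) →L[ℝ] ℝ) :
    MvPolynomial (Fin s) ℝ →ₐ[ℝ] Module.End ℝ (HalfSpaceFun y) :=
  polyOpHom (fun j => -dirDeriv y (Pi.single j 1)) fun i j => by
    rw [neg_mul_neg, neg_mul_neg, dirDeriv_comm]

theorem derivRep_X (j : Fin s) : derivRep y (X j) = -dirDeriv y (Pi.single j 1) :=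
  polyOpHom_X _ _ _

theorem derivRep_linForm (v : Fin s → ℝ) : derivRep y (linForm v) = -dirDeriv y v := by
  refine LinearMap.ext fun f => HalfSpaceFun.ext fun x => ?_
  have h (j : Fin s) : (derivRep y (C (v j) * X j) f).1 x =
      -(v j * fderiv ℝ f.1 x (Pi.single j 1)) := by
    rw [map_mul, Module.End.mul_apply, ← algebraMap_eq, AlgHom.commutes, derivRep_X,
      Module.algebraMap_end_apply, HalfSpaceFun.smul_apply, LinearMap.neg_apply,
      HalfSpaceFun.neg_apply, dirDeriv_apply, mul_neg]
  rw [linForm, map_sum, LinearMap.sum_apply, HalfSpaceFun.sum_apply, LinearMap.neg_apply,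
    HalfSpaceFun.neg_apply, dirDeriv_apply]
  simp only [h]
  conv_rhs => rw [pi_eq_sum_univ' v, map_sum, ← Finset.sum_neg_distrib]
  simp

/-- For a variable this is the product rule for x_j f; commutators with `mulCoord y j` obey the
Leibniz rule, which extends it to all P. -/
theorem derivRep_commutator (P : MvPolynomial (Fin s) ℝ) (j : Fin s) :
    derivRep y P * mulCoord y j - mulCoord y j * derivRep y P = -derivRep y (pderiv j P) := by
  induction P using MvPolynomial.induction_on with
  | C c =>
    rw [pderiv_C, map_zero, neg_zero, ← algebraMap_eq, AlgHom.commutes, Algebra.commutes, sub_self]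
  | add P Q hP hQ =>
    rw [map_add, map_add, map_add, add_mul, mul_add, add_sub_add_comm, hP, hQ]
    abel
  | mul_X P i hP =>
    have h1 : derivRep y (X i) * mulCoord y j - mulCoord y j * derivRep y (X i) =
        -derivRep y (pderiv j (X i)) := by
      rw [derivRep_X]
      refine LinearMap.ext fun f => HalfSpaceFun.ext fun x => ?_
      have h2 : (dirDeriv y (Pi.single i 1) (mulCoord y j f)).1 x =
          x j * fderiv ℝ f.1 x (Pi.single i 1) + f.1 x * (Pi.single i 1 : Fin s → ℝ) j := by
        have h3 : HasFDerivAt (fun x : Fin s → ℝ => x j)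
            (ContinuousLinearMap.proj (R := ℝ) (φ := fun _ : Fin s => ℝ) j) x := hasFDerivAt_apply j x
        have := (h3.mul (f.differentiable x).hasFDerivAt).fderiv
        change fderiv ℝ (fun x => x j * f.1 x) x _ = _
        rw [show (fun x : Fin s → ℝ => x j * f.1 x) = (fun x : Fin s → ℝ => x j) * f.1 from rfl, this]
        simp
      change -(dirDeriv y (Pi.single i 1) (mulCoord y j f)).1 x -
        x j * -(fderiv ℝ f.1 x (Pi.single i 1)) = _
      rw [h2, pderiv_X]
      by_cases hij : i = j
      · subst hij; simp; rfl
      · simp [hij, Ne.symm hij]; rfl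
    rw [pderiv_mul, map_add, map_mul, map_mul, map_mul, mul_assoc, neg_add, ← mul_neg (derivRep y P),
      ← h1, ← neg_mul, ← hP]
    noncomm_ring

/-- Multiplication by `p(-x)`. -/
noncomputable def mulReflect (y : (Fin s → ℝ) →L[ℝ] ℝ) :
    MvPolynomial (Fin s) ℝ →ₐ[ℝ] Module.End ℝ (HalfSpaceFun y) :=
  polyOpHom (fun j => -mulCoord y j) fun i j => by
    refine LinearMap.ext fun f => HalfSpaceFun.ext fun x => ?_
    simp only [neg_mul_neg, Module.End.mul_apply, mulCoord_apply]
    ring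

theorem mulReflect_X (j : Fin s) : mulReflect y (X j) = -mulCoord y j := polyOpHom_X _ _ _

theorem mulReflect_apply (p : MvPolynomial (Fin s) ℝ) (f : HalfSpaceFun y) (x : Fin s → ℝ) :
    (mulReflect y p f).1 x = eval x (reflect p) * f.1 x := by
  induction p using MvPolynomial.induction_on generalizing f with
  | C c =>
    rw [reflect, aeval_C, algebraMap_eq, eval_C, ← algebraMap_eq, AlgHom.commutes]
    rfl
  | add p q hp hq =>
    rw [map_add, LinearMap.add_apply, reflect, map_add, map_add, add_mul]
    exact congrArg₂ _ (hp f) (hq f)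
  | mul_X p j hp =>
    rw [map_mul, Module.End.mul_apply, hp, mulReflect_X, LinearMap.neg_apply,
      HalfSpaceFun.neg_apply, mulCoord_apply, reflect, reflect, map_mul, map_mul, aeval_X, map_neg, eval_X]
    ring

/-- Integration along the rays with direction `v`. -/
noncomputable def rayOp (y : (Fin s → ℝ) →L[ℝ] ℝ) (v : Fin s → ℝ) (hv : 0 < y v) :
    Module.End ℝ (HalfSpaceFun y) where
  toFun f := ⟨rayIntegral v f.1, by
      obtain ⟨hf, R, hR⟩ := f.2
      exact ⟨contDiff_rayIntegral hv hf hR, R, rayIntegral_eq_zero hv hR⟩⟩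
  map_add' f g := by
    obtain ⟨hf, R, hR⟩ := f.2
    obtain ⟨hg, R', hR'⟩ := g.2
    refine HalfSpaceFun.ext fun x => ?_
    exact integral_add (integrableOn_ray hv hf.continuous hR x)
      (integrableOn_ray hv hg.continuous hR' x)
  map_smul' c f := by
    refine HalfSpaceFun.ext fun x => ?_
    exact integral_const_mul c _

theorem rayOp_apply {v : Fin s → ℝ} (hv : 0 < y v) (f : HalfSpaceFun y) (x : Fin s → ℝ) :
    (rayOp y v hv f).1 x = ∫ t in Set.Ioi (0 : ℝ), f.1 (x + t • v) := rfl

theorem derivRep_mul_rayOp {v : Fin s → ℝ} (hv : 0 < y v) :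
    derivRep y (linForm v) * rayOp y v hv = 1 := by
  refine LinearMap.ext fun f => HalfSpaceFun.ext fun x => ?_
  obtain ⟨hf, R, hR⟩ := f.2
  rw [derivRep_linForm]
  change -(fderiv ℝ (rayIntegral v f.1) x v) = f.1 x
  rw [fderiv_rayIntegral hv hf hR, neg_neg]

theorem rayOp_mul_derivRep {v : Fin s → ℝ} (hv : 0 < y v) :
    rayOp y v hv * derivRep y (linForm v) = 1 := by
  refine LinearMap.ext fun f => HalfSpaceFun.ext fun x => ?_
  obtain ⟨hf, R, hR⟩ := f.2
  rw [derivRep_linForm, mul_neg]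
  change -(rayIntegral v (fun z => fderiv ℝ f.1 z v) x) = f.1 x
  rw [rayIntegral_fderiv hv hf hR, neg_neg]

/-- Evaluation at the origin. -/
def evalZero (y : (Fin s → ℝ) →L[ℝ] ℝ) : HalfSpaceFun y →ₗ[ℝ] ℝ where
  toFun f := f.1 0
  map_add' _ _ := rfl
  map_smul' _ _ := rfl

/-- The positive orthant. -/
def orthant (n : ℕ) : Set (Fin n → ℝ) := {t | ∀ i, 0 ≤ t i}

theorem isClosed_orthant (n : ℕ) : IsClosed (orthant n) := by
  have : orthant n = ⋂ i, {t | 0 ≤ t i} := by ext; simp [orthant]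
  rw [this]
  exact isClosed_iInter fun i => isClosed_le continuous_const (continuous_apply i)

theorem measurableSet_orthant (n : ℕ) : MeasurableSet (orthant n) := (isClosed_orthant n).measurableSet

/-- The points of the orthant that are sent to a given half space form a bounded set. -/
theorem exists_orthant_bound {n : ℕ} {z : Fin n → Fin s → ℝ} (hz : ∀ k, 0 < y (z k)) (C : ℝ) :
    ∃ T : ℝ, ∀ t ∈ orthant n, y (∑ k, t k • z k) ≤ C → t ∈ Set.Icc 0 fun _ => T := by
  obtain ⟨T, hT⟩ : ∃ T : ℝ, ∀ k, C / y (z k) ≤ T := by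
    obtain ⟨T, hT⟩ := (Set.finite_range fun k => C / y (z k)).bddAbove
    exact ⟨T, fun k => hT ⟨k, rfl⟩⟩
  refine ⟨T, fun t ht h => ⟨ht, fun k => (le_trans ?_ (hT k))⟩⟩
  rw [le_div_iff₀ (hz k)]
  refine le_trans ?_ h
  rw [map_sum]
  simp only [map_smul, smul_eq_mul]
  exact Finset.single_le_sum (f := fun k => t k * y (z k))
    (fun k _ => mul_nonneg (ht k) (hz k).le) (Finset.mem_univ k)

theorem integrableOn_orthant {n : ℕ} {z : Fin n → Fin s → ℝ} (hz : ∀ k, 0 < y (z k))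
    {f : (Fin s → ℝ) → ℝ} (hf : Continuous f) {R : ℝ} (hR : ∀ x, R < y x → f x = 0)
    (x : Fin s → ℝ) :
    IntegrableOn (fun t : Fin n → ℝ => f (x + ∑ k, t k • z k)) (orthant n) := by
  obtain ⟨T, hT⟩ := exists_orthant_bound hz (R - y x)
  have h1 : IntegrableOn (fun t : Fin n → ℝ => f (x + ∑ k, t k • z k)) (Set.Icc 0 fun _ => T) :=
    ContinuousOn.integrableOn_compact isCompact_Icc (Continuous.continuousOn (by fun_prop))
  refine h1.of_forall_sdiff_eq_zero (measurableSet_orthant n) fun t ht => hR _ ?_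
  by_contra h
  refine ht.2 (hT t ht.1 ?_)
  rw [map_add] at h
  linarith

/-- Fubini, splitting off the first coordinate. Integrability holds because y > 0 on the z_k
confines the relevant part of the orthant to a box. -/
theorem listProd_rayOp_apply {n : ℕ} (z : Fin n → Fin s → ℝ) (hz : ∀ k, 0 < y (z k))
    (f : HalfSpaceFun y) (x : Fin s → ℝ) :
    ((List.ofFn fun k => rayOp y (z k) (hz k)).prod f).1 x =
      ∫ t in orthant n, f.1 (x + ∑ k, t k • z k) := by
  induction n generalizing x with
  | zero =>
    have : orthant 0 = Set.univ := by ext; simp [orthant]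
    rw [this, Measure.restrict_univ, volume_pi, Measure.pi_of_empty, integral_dirac]
    simp
  | succ n ih =>
    obtain ⟨hf, R, hR⟩ := f.2
    rw [List.ofFn_succ, List.prod_cons, Module.End.mul_apply, rayOp_apply]
    simp only [ih (fun k => z k.succ) fun k => hz k.succ]
    have hmp := (volume_preserving_piFinSuccAbove (fun _ : Fin (n + 1) => ℝ) 0).symm
    have hpre : (MeasurableEquiv.piFinSuccAbove (fun _ : Fin (n + 1) => ℝ) 0).symm ⁻¹'
        orthant (n + 1) = Set.Ici 0 ×ˢ orthant n := by
      ext p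
      simp [orthant, Fin.forall_fin_succ]
    have hfun (p : ℝ × (Fin n → ℝ)) :
        x + ∑ k, (MeasurableEquiv.piFinSuccAbove (fun _ : Fin (n + 1) => ℝ) 0).symm p k • z k =
          x + p.1 • z 0 + ∑ k, p.2 k • z k.succ := by
      simp [Fin.sum_univ_succ, add_assoc]
    have hint := integrableOn_orthant hz hf.continuous hR x
    rw [← hmp.integrableOn_comp_preimage (MeasurableEquiv.measurableEmbedding _), hpre] at hint
    rw [← hmp.setIntegral_preimage_emb (MeasurableEquiv.measurableEmbedding _), hpre]
    simp only [Function.comp_def, hfun] at hint ⊢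
    rw [Measure.volume_eq_prod] at hint ⊢
    rw [setIntegral_prod _ hint, integral_Ici_eq_integral_Ioi]

end HalfSpace

/-! ### The spline as a sum of polynomials on the cones of the no broken bases. -/

section SplineFormula

open scoped ContDiff

variable {s N : ℕ} {a : Fin N → Fin s → ℝ} {y : (Fin s → ℝ) →L[ℝ] ℝ}

/-- The `k`-th element of a no broken basis. -/
noncomputable def nbVector (a : Fin N → Fin s → ℝ) (b : NB a) (k : Fin s) : Fin s → ℝ :=
  a (b.1.orderEmbOfFin b.2.1.card_eq k)

theorem sum_orderEmbOfFin {M : Type*} [AddCommMonoid M] (b : NB a) (f : Fin N → M) :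
    ∑ k, f (b.1.orderEmbOfFin b.2.1.card_eq k) = ∑ i ∈ b.1, f i := by
  conv_rhs => rw [← Finset.map_orderEmbOfFin_univ b.1 b.2.1.card_eq, Finset.sum_map]
  rfl

theorem listProd_eq_prod_nbVector (b : NB a) :
    listProd a b.1 = ∏ k, linForm (nbVector a b k) := by
  rw [listProd]
  conv_lhs => rw [← Finset.map_orderEmbOfFin_univ b.1 b.2.1.card_eq, Finset.prod_map]
  rfl

/-- Both sides are values at 0 of operators representing 1/∏_{a∈X} a, one built from the whole list
and the other from its polar expansion. Evaluation at 0 kills multiples of x_j, so each p_b(∂) turns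
into multiplication of f by p_b(-x). -/
theorem integral_orthant_eq_sum (hy : ∀ i, 0 < y (a i)) {p : NB a → MvPolynomial (Fin s) ℝ}
    (hp : IsPolarFamily a p) (f : HalfSpaceFun y) :
    ∫ t in orthant N, f.1 (∑ i, t i • a i) =
      ∑ b, ∫ t in orthant s, eval (∑ k, t k • nbVector a b k) (reflect (p b)) *
        f.1 (∑ k, t k • nbVector a b k) := by
  have hne {v : Fin s → ℝ} (hv : 0 < y v) : v ≠ 0 := fun h => by simp [h] at hv
  have hy' (b : NB a) (k : Fin s) : 0 < y (nbVector a b k) := hy _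
  have h1 : Represents (derivRep y) (invProd a Finset.univ)
      (List.ofFn fun i => rayOp y (a i) (hy i)).prod :=
    represents_inv_prod a (fun i => hne (hy i)) _ (fun i => derivRep_mul_rayOp (hy i))
      fun i => rayOp_mul_derivRep (hy i)
  have h2 (b : NB a) : Represents (derivRep y) (invProd a b.1)
      (List.ofFn fun k => rayOp y (nbVector a b k) (hy' b k)).prod := by
    rw [invProd, listProd_eq_prod_nbVector]
    exact represents_inv_prod _ (fun k => hne (hy' b k)) _ (fun k => derivRep_mul_rayOp (hy' b k))
      fun k => rayOp_mul_derivRep (hy' b k)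
  have h3 (b : NB a) := (h2 b).exists_ratDiffHom derivRep_commutator (mulReflect y) mulReflect_X
    (evalZero y) (fun j f => zero_mul (f.1 0)) (p b)
  choose A hA hA' using h3
  have h4 := Represents.sum Finset.univ fun b _ => hA b
  have h5 := hp.2
  simp only [ratDiffOp_eq] at h5
  rw [← h5] at h4
  have h6 := congrArg (fun B => evalZero y (B f)) (h1.unique h4)
  simp only [LinearMap.sum_apply, map_sum, hA'] at h6
  have h7 := listProd_rayOp_apply a hy f 0
  simp only [zero_add] at h7
  rw [← h7]
  refine h6.trans (Finset.sum_congr rfl fun b _ => ?_)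
  have h8 := listProd_rayOp_apply (nbVector a b) (hy' b) (mulReflect y (p b) f) 0
  simp only [zero_add, mulReflect_apply] at h8
  exact h8

/-- The linear map that sends the standard basis to a no broken basis. -/
noncomputable def nbMap (a : Fin N → Fin s → ℝ) (b : NB a) : (Fin s → ℝ) →ₗ[ℝ] (Fin s → ℝ) :=
  Matrix.toLin' (Matrix.of (nbVector a b)).transpose

theorem nbMap_apply (b : NB a) (t : Fin s → ℝ) : nbMap a b t = ∑ k, t k • nbVector a b k := by
  rw [nbMap, Matrix.toLin'_apply, Matrix.mulVec_transpose, Matrix.vecMul_eq_sum]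
  rfl

theorem nbMap_det_ne_zero (b : NB a) : LinearMap.det (nbMap a b) ≠ 0 := by
  rw [nbMap, LinearMap.det_toLin', Matrix.det_transpose, ← isUnit_iff_ne_zero,
    ← Matrix.isUnit_iff_isUnit_det, ← Matrix.linearIndependent_rows_iff_isUnit]
  have h : LinearIndependent ℝ fun i : (b.1 : Set (Fin N)) => a i := b.2.1.1
  exact h.comp (fun k => ⟨b.1.orderEmbOfFin b.2.1.card_eq k, b.1.orderEmbOfFin_mem _ k⟩)
    fun k l hkl => (b.1.orderEmbOfFin b.2.1.card_eq).injective (congrArg Subtype.val hkl)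

theorem absDet_eq (b : NB a) : absDet a b = |LinearMap.det (nbMap a b)| := by
  rw [nbMap, LinearMap.det_toLin', Matrix.det_transpose]
  rfl

theorem nbMap_injective (b : NB a) : Function.Injective (nbMap a b) := by
  rw [← LinearMap.ker_eq_bot]
  by_contra h
  exact nbMap_det_ne_zero b (LinearMap.det_eq_zero_iff_ker_ne_bot.2 h)

theorem isClosedEmbedding_nbMap (b : NB a) : Topology.IsClosedEmbedding (nbMap a b) :=
  LinearMap.isClosedEmbedding_of_injective (LinearMap.ker_eq_bot.2 (nbMap_injective b))

theorem cone_eq_image (b : NB a) : cone a b.1 = nbMap a b '' orthant s := by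
  ext x
  constructor
  · rintro ⟨t, ht, rfl⟩
    refine ⟨fun k => t (b.1.orderEmbOfFin b.2.1.card_eq k), fun k => ht _, ?_⟩
    rw [nbMap_apply]
    exact sum_orderEmbOfFin b fun i => t i • a i
  · rintro ⟨t, ht, rfl⟩
    have hinj := (b.1.orderEmbOfFin b.2.1.card_eq).injective
    refine ⟨Function.extend (b.1.orderEmbOfFin b.2.1.card_eq) t 0, fun i => ?_, ?_⟩
    · by_cases h : ∃ k, b.1.orderEmbOfFin b.2.1.card_eq k = i
      · obtain ⟨k, rfl⟩ := h
        rw [hinj.extend_apply]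
        exact ht k
      · rw [Function.extend_apply' _ _ _ h]
        exact le_rfl
    · rw [nbMap_apply, ← sum_orderEmbOfFin b fun i =>
        Function.extend (b.1.orderEmbOfFin b.2.1.card_eq) t 0 i • a i]
      simp only [hinj.extend_apply]
      rfl

theorem isClosed_cone (b : NB a) : IsClosed (cone a b.1) := by
  rw [cone_eq_image]
  exact (isClosedEmbedding_nbMap b).isClosedMap _ (isClosed_orthant s)

theorem integral_orthant_eq_integral_cone (b : NB a) (g : (Fin s → ℝ) → ℝ) :
    ∫ t in orthant s, g (∑ k, t k • nbVector a b k) = (absDet a b)⁻¹ * ∫ x in cone a b.1, g x := by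
  have h1 : nbMap a b ⁻¹' cone a b.1 = orthant s := by
    rw [cone_eq_image, Set.preimage_image_eq _ (nbMap_injective b)]
  have h2 := (isClosedEmbedding_nbMap b).measurableEmbedding.setIntegral_map (μ := volume) g
    (cone a b.1)
  rw [h1, Real.map_linearMap_volume_pi_eq_smul_volume_pi (nbMap_det_ne_zero b),
    Measure.restrict_smul, integral_smul_measure, ENNReal.toReal_ofReal (abs_nonneg _), abs_inv,
    ← absDet_eq, smul_eq_mul] at h2
  simp only [nbMap_apply] at h2
  exact h2.symm

/-- The piecewise polynomial function given by a polar family. -/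
noncomputable def piecewiseSpline (a : Fin N → Fin s → ℝ) (p : NB a → MvPolynomial (Fin s) ℝ)
    (x : Fin s → ℝ) : ℝ :=
  ∑ b, (cone a b.1).indicator (fun x => (absDet a b)⁻¹ * eval x (reflect (p b))) x

theorem continuous_piece (p : NB a → MvPolynomial (Fin s) ℝ) (b : NB a) :
    Continuous fun x => (absDet a b)⁻¹ * eval x (reflect (p b)) :=
  continuous_const.mul (MvPolynomial.continuous_eval _)

theorem locallyIntegrable_piecewiseSpline (p : NB a → MvPolynomial (Fin s) ℝ) :
    LocallyIntegrable (piecewiseSpline a p) volume :=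
  locallyIntegrable_finsetSum _ fun b _ =>
    (continuous_piece p b).locallyIntegrable.indicator (isClosed_cone b).measurableSet

theorem integral_mul_piecewiseSpline {f : (Fin s → ℝ) → ℝ} (hf : Continuous f)
    (hf' : HasCompactSupport f) (p : NB a → MvPolynomial (Fin s) ℝ) :
    ∫ x, f x * piecewiseSpline a p x = ∑ b, ∫ t in orthant s,
      eval (∑ k, t k • nbVector a b k) (reflect (p b)) * f (∑ k, t k • nbVector a b k) := by
  simp only [piecewiseSpline, Finset.mul_sum]
  have h (b : NB a) : (fun x => f x * (cone a b.1).indicator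
      (fun x => (absDet a b)⁻¹ * eval x (reflect (p b))) x) =
      (cone a b.1).indicator fun x => (absDet a b)⁻¹ * (eval x (reflect (p b)) * f x) := by
    ext x
    by_cases hx : x ∈ cone a b.1
    · simp only [Set.indicator_of_mem hx]; ring
    · simp only [Set.indicator_of_notMem hx, mul_zero]
  rw [integral_finsetSum]
  · refine Finset.sum_congr rfl fun b _ => ?_
    rw [h, integral_indicator (isClosed_cone b).measurableSet, integral_const_mul,
      integral_orthant_eq_integral_cone b fun x => eval x (reflect (p b)) * f x]
  · intro b _
    rw [h]
    refine Integrable.indicator ?_ (isClosed_cone b).measurableSet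
    refine Continuous.integrable_of_hasCompactSupport ?_ ?_
    · exact continuous_const.mul ((MvPolynomial.continuous_eval _).mul hf)
    · exact (hf'.mul_left).mul_left

/-- The common support bounds all integrands by a multiple of |T| on the support of f. The measure
is general because the lemma serves both the Lebesgue measure with the spline as T and the spline
measure with T = 1. -/
theorem tendsto_integral_mul_of_approx {μ : Measure (Fin s → ℝ)} {T : (Fin s → ℝ) → ℝ}
    (hT : LocallyIntegrable T μ) {f : (Fin s → ℝ) → ℝ} (hf : Continuous f)
    (hf' : HasCompactSupport f) {g : ℕ → (Fin s → ℝ) → ℝ} (hg : ∀ n, Continuous (g n))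
    (hgf : ∀ n x, dist (g n x) (f x) < 1 / ((n : ℝ) + 1))
    (hs : ∀ n, Function.support (g n) ⊆ Function.support f) :
    Filter.Tendsto (fun n => ∫ x, g n x * T x ∂μ) Filter.atTop (nhds (∫ x, f x * T x ∂μ)) := by
  obtain ⟨C, hC⟩ := hf'.exists_bound_of_continuous hf
  refine tendsto_integral_of_dominated_convergence
    ((tsupport f).indicator fun x => (C + 1) * ‖T x‖) (fun n => ?_) ?_ (fun n => ?_) ?_
  · exact (hg n).aestronglyMeasurable.mul hT.aestronglyMeasurable
  · rw [integrable_indicator_iff (isClosed_tsupport f).measurableSet]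
    exact ((hT.integrableOn_isCompact hf').norm).const_mul _
  · refine Filter.Eventually.of_forall fun x => ?_
    by_cases hx : x ∈ tsupport f
    · rw [Set.indicator_of_mem hx, norm_mul]
      refine mul_le_mul_of_nonneg_right ?_ (norm_nonneg _)
      have h1 := hgf n x
      rw [dist_eq_norm] at h1
      have h2 : 1 / ((n : ℝ) + 1) ≤ 1 := by
        rw [div_le_one (by positivity)]
        linarith [Nat.cast_nonneg (α := ℝ) n]
      have h3 := norm_sub_norm_le (g n x) (f x)
      linarith [hC x]
    · have : g n x = 0 := by
        by_contra h
        exact hx (subset_tsupport f (hs n h))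
      rw [Set.indicator_of_notMem hx, this, zero_mul, norm_zero]
  · refine Filter.Eventually.of_forall fun x => Filter.Tendsto.mul_const _ ?_
    rw [tendsto_iff_dist_tendsto_zero]
    exact squeeze_zero (fun n => dist_nonneg) (fun n => (hgf n x).le)
      tendsto_one_div_add_atTop_nhds_zero_nat

/-- The image of the Lebesgue measure of the orthant. -/
noncomputable def splineMeasure (a : Fin N → Fin s → ℝ) : Measure (Fin s → ℝ) :=
  (volume.restrict (orthant N)).map fun t => ∑ i, t i • a i

theorem integral_splineMeasure (a : Fin N → Fin s → ℝ) {f : (Fin s → ℝ) → ℝ} (hf : Continuous f) :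
    ∫ x, f x ∂splineMeasure a = ∫ t in orthant N, f (∑ i, t i • a i) :=
  integral_map (Continuous.aemeasurable (by fun_prop)) hf.aestronglyMeasurable

theorem isFiniteMeasureOnCompacts_splineMeasure (hy : ∀ i, 0 < y (a i)) :
    IsFiniteMeasureOnCompacts (splineMeasure a) := by
  refine ⟨fun Q hQ => ?_⟩
  obtain ⟨C, hC⟩ := (hQ.image y.continuous).bddAbove
  obtain ⟨T, hT⟩ := exists_orthant_bound hy C
  rw [splineMeasure, Measure.map_apply (Continuous.measurable (by fun_prop)) hQ.measurableSet,
    Measure.restrict_apply' (measurableSet_orthant N)]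
  refine lt_of_le_of_lt (measure_mono (t := Set.Icc 0 fun _ => T) ?_) isCompact_Icc.measure_lt_top
  rintro t ⟨ht1, ht2⟩
  exact hT t ht2 (hC ⟨_, ht1, rfl⟩)

/-- Smooth test functions of compact support vanish where y is large, so the operator identity
covers them; continuous ones follow by uniform smooth approximation within the same support. -/
theorem isMultivariateSpline_piecewiseSpline (hy : ∀ i, 0 < y (a i))
    {p : NB a → MvPolynomial (Fin s) ℝ} (hp : IsPolarFamily a p) :
    IsMultivariateSpline a (piecewiseSpline a p) := by
  refine ⟨locallyIntegrable_piecewiseSpline p, fun f hf hf' => ?_⟩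
  have h1 (n : ℕ) : 0 < 1 / ((n : ℝ) + 1) := by positivity
  choose g hg hgf hgs using fun n : ℕ =>
    hf.exists_contDiff_approx ⊤ (ε := fun _ => 1 / ((n : ℝ) + 1)) continuous_const fun _ => h1 n
  have hgc (n : ℕ) : Continuous (g n) := (hg n).continuous
  have hgs' (n : ℕ) : HasCompactSupport (g n) := hf'.mono (hgs n)
  have := isFiniteMeasureOnCompacts_splineMeasure hy
  have h2 := tendsto_integral_mul_of_approx (locallyIntegrable_piecewiseSpline p) hf hf' hgc hgf hgs
  have h3 := tendsto_integral_mul_of_approx (μ := splineMeasure a) (T := fun _ => 1)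
    continuous_const.locallyIntegrable hf hf' hgc hgf hgs
  simp only [mul_one] at h3
  have h4 (n : ℕ) : ∫ x, g n x * piecewiseSpline a p x = ∫ x, g n x ∂splineMeasure a := by
    obtain ⟨R, hR⟩ := ((hgs' n).isCompact.image y.continuous).bddAbove
    let f' : HalfSpaceFun y := ⟨g n, hg n, R, fun x hx => by
      by_contra h
      exact absurd (hR ⟨x, subset_tsupport _ h, rfl⟩) (not_le.2 hx)⟩
    rw [integral_mul_piecewiseSpline (hgc n) (hgs' n), integral_splineMeasure a (hgc n)]
    exact (integral_orthant_eq_sum hy hp f').symm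
  simp only [h4] at h2
  rw [tendsto_nhds_unique h2 h3, integral_splineMeasure a hf]
  rfl

end SplineFormula

/-! ### Big cells and the local polynomials of the spline. -/

section BigCells

variable {s N : ℕ} {a : Fin N → Fin s → ℝ} {y : (Fin s → ℝ) →L[ℝ] ℝ}

theorem exists_pos_of_zero_notMem_convexHull (h : (0 : Fin s → ℝ) ∉ convexHull ℝ (Set.range a)) :
    ∃ y : (Fin s → ℝ) →L[ℝ] ℝ, ∀ i, 0 < y (a i) := by
  obtain ⟨y, u, hy, hu⟩ := geometric_hahn_banach_point_closed (convex_convexHull ℝ _)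
    ((Set.finite_range a).isClosed_convexHull ℝ) h
  rw [map_zero] at hy
  exact ⟨y, fun i => hy.trans (hu _ (subset_convexHull ℝ _ ⟨i, rfl⟩))⟩

theorem cone_subset_cone_univ (Y : Finset (Fin N)) : cone a Y ⊆ cone a Finset.univ := by
  classical
  rintro x ⟨t, ht, rfl⟩
  refine ⟨fun i => if i ∈ Y then t i else 0, fun i => ?_, ?_⟩
  · dsimp only
    split_ifs
    exacts [ht i, le_rfl]
  · simp [ite_smul, Finset.sum_ite_mem]

/-- The cone of the list is covered by the cones of the no broken bases: off these cones the spline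
vanishes, while it is positive in the mean near each point of the cone of the list. -/
theorem cone_univ_eq_iUnion (hy : ∀ i, 0 < y (a i))
    (hs : Submodule.span ℝ (Set.range a) = ⊤) :
    cone a Finset.univ = ⋃ b : NB a, cone a b.1 := by
  refine subset_antisymm ?_ (Set.iUnion_subset fun b => cone_subset_cone_univ _)
  rintro x ⟨t, ht, hx⟩
  by_contra hxU
  obtain ⟨p, hp⟩ := exists_isPolarFamily (fun i h => by simpa [h] using hy i) hs
  have hT := (isMultivariateSpline_piecewiseSpline hy hp).2
  have hU : IsOpen (⋃ b : NB a, cone a b.1)ᶜ :=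
    (isClosed_iUnion_of_finite isClosed_cone).isOpen_compl
  obtain ⟨f, hf1, hf2, hf3, hf4, hf5⟩ :=
    exists_contDiff_tsupport_subset (n := ⊤) (hU.mem_nhds hxU)
  have hf0 (x) : 0 ≤ f x := (hf4 ⟨x, rfl⟩).1
  have h0 : ∫ x, f x * piecewiseSpline a p x = 0 := by
    rw [← integral_zero (Fin s → ℝ) ℝ]
    congr 1 with z
    by_cases hz : z ∈ tsupport f
    · have hz' := hf1 hz
      simp only [Set.mem_compl_iff, Set.mem_iUnion, not_exists] at hz'
      simp [piecewiseSpline, hz']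
    · rw [image_eq_zero_of_notMem_tsupport hz, zero_mul]
  have h1 : ∫ t in orthant N, f (∑ i, t i • a i) = 0 := (hT f hf3.continuous hf2).symm.trans h0
  obtain ⟨R, hR⟩ := (hf2.isCompact.image y.continuous).bddAbove
  have hint := integrableOn_orthant hy hf3.continuous (R := R) (fun z hz => by
    by_contra h
    exact absurd (hR ⟨z, subset_tsupport _ h, rfl⟩) (not_le.2 hz)) 0
  simp only [zero_add] at hint
  rw [setIntegral_eq_zero_iff_of_nonneg_ae (Filter.Eventually.of_forall fun t => hf0 _) hint] at h1
  have hc : Continuous fun t : Fin N → ℝ => f (∑ i, t i • a i) :=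
    hf3.continuous.comp (by fun_prop)
  -- The parameters t of x may lie on the boundary of the orthant. Adding a small ε to all of them
  -- reaches the open orthant with f still positive, so the integral of f over the orthant cannot
  -- vanish.
  set O : Set (Fin N → ℝ) :=
    (fun t => f (∑ i, t i • a i)) ⁻¹' Set.Ioi 0 ∩ Set.univ.pi fun _ => Set.Ioi 0 with hO
  have hOo : IsOpen O :=
    (isOpen_Ioi.preimage hc).inter (isOpen_set_pi Set.finite_univ fun _ _ => isOpen_Ioi)
  have hOne : O.Nonempty := by
    have h2 : Filter.Tendsto (fun ε : ℝ => fun i => t i + ε) (nhdsWithin 0 (Set.Ioi 0)) (nhds t) := by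
      have : Continuous fun ε : ℝ => fun i => t i + ε := by fun_prop
      simpa using (this.tendsto 0).mono_left nhdsWithin_le_nhds
    have h3 : (fun t => f (∑ i, t i • a i)) ⁻¹' Set.Ioi 0 ∈ nhds t :=
      (isOpen_Ioi.preimage hc).mem_nhds (by simp [← hx, hf5])
    obtain ⟨ε, hε, hε'⟩ := ((h2.eventually h3).and self_mem_nhdsWithin).exists
    exact ⟨_, hε, fun i _ => add_pos_of_nonneg_of_pos (ht i) hε'⟩
  refine (hOo.measure_pos volume hOne).ne' ?_
  have h2 := (ae_restrict_iff' (measurableSet_orthant N)).1 h1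
  rw [ae_iff] at h2
  refine measure_mono_null (fun t ht => ?_) h2
  simp only [Set.mem_ofPred_eq, Classical.not_imp]
  exact ⟨fun i => (ht.2 i trivial).le, (show 0 < f _ from ht.1).ne'⟩

/-- As the cones C(b) cover C(X), a regular point lies in some C(b) and off its boundary, hence in
its interior. -/
theorem isOpen_regularPoints (hy : ∀ i, 0 < y (a i))
    (hs : Submodule.span ℝ (Set.range a) = ⊤) : IsOpen (regularPoints a) := by
  have h : regularPoints a =
      (⋃ b : NB a, interior (cone a b.1)) \ ⋃ b : NB a, frontier (cone a b.1) := by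
    ext x
    rw [regularPoints, cone_univ_eq_iUnion hy hs]
    simp only [Set.mem_sdiff, Set.mem_iUnion, not_exists]
    refine and_congr_left fun h => exists_congr fun b => ⟨fun hb => ?_, fun hb => interior_subset hb⟩
    by_contra hb'
    exact h b ⟨subset_closure hb, hb'⟩
  rw [h]
  exact (isOpen_iUnion fun b => isOpen_interior).sdiff
    (isClosed_iUnion_of_finite fun b => isClosed_frontier)

theorem IsBigCell.isOpen {c : Set (Fin s → ℝ)} (hc : IsBigCell a c) (hy : ∀ i, 0 < y (a i))
    (hs : Submodule.span ℝ (Set.range a) = ⊤) : IsOpen c := by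
  obtain ⟨x, hx, rfl⟩ := hc
  exact (isOpen_regularPoints hy hs).connectedComponentIn

/-- A big cell is connected and avoids the boundary of C(b). -/
theorem IsBigCell.subset_or_disjoint {c : Set (Fin s → ℝ)} (hc : IsBigCell a c) (b : NB a) :
    c ⊆ cone a b.1 ∨ Disjoint c (cone a b.1) := by
  have h : c ⊆ interior (cone a b.1) ∪ (closure (cone a b.1))ᶜ := by
    obtain ⟨x, hx, rfl⟩ := hc
    intro z hz
    have hz' := (connectedComponentIn_subset _ _ hz).2
    simp only [Set.mem_iUnion, not_exists] at hz'
    by_contra h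
    rw [Set.mem_union, Set.mem_compl_iff, not_or, not_not] at h
    exact hz' b ⟨h.2, h.1⟩
  have hc' : IsPreconnected c := by
    obtain ⟨x, hx, rfl⟩ := hc
    exact isPreconnected_connectedComponentIn
  have hd : Disjoint (interior (cone a b.1)) (closure (cone a b.1))ᶜ :=
    disjoint_compl_right.mono_left (interior_subset.trans subset_closure)
  refine (hc'.subset_or_subset isOpen_interior isClosed_closure.isOpen_compl hd h).imp
    (fun h => h.trans interior_subset) fun h => ?_
  exact (disjoint_compl_left.mono_left h).mono_right subset_closure

open scoped Classical in
/-- The polynomial that represents the multivariate spline on a big cell. -/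
noncomputable def cellPolynomial (a : Fin N → Fin s → ℝ) (p : NB a → MvPolynomial (Fin s) ℝ)
    (c : Set (Fin s → ℝ)) : MvPolynomial (Fin s) ℝ :=
  ∑ b, if c ⊆ cone a b.1 then (absDet a b)⁻¹ • reflect (p b) else 0

theorem IsBigCell.piecewiseSpline_eq {c : Set (Fin s → ℝ)} (hc : IsBigCell a c)
    (p : NB a → MvPolynomial (Fin s) ℝ) {x : Fin s → ℝ} (hx : x ∈ c) :
    piecewiseSpline a p x = eval x (cellPolynomial a p c) := by
  rw [piecewiseSpline, cellPolynomial, map_sum]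
  refine Finset.sum_congr rfl fun b _ => ?_
  split_ifs with h
  · rw [Set.indicator_of_mem (h hx), smul_eval]
  · rw [map_zero, Set.indicator_of_notMem]
    exact Set.disjoint_left.1 ((hc.subset_or_disjoint b).resolve_left h) hx

theorem cellPolynomial_mem_DXdeg {p : NB a → MvPolynomial (Fin s) ℝ} (hp : IsPolarFamily a p)
    (ha : ∀ i, a i ≠ 0) (c : Set (Fin s → ℝ)) : cellPolynomial a p c ∈ DXdeg a (N - s) := by
  refine Submodule.sum_mem _ fun b _ => ?_
  split_ifs
  · rw [reflect_eq (hp.1 b)]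
    exact Submodule.smul_mem _ _ (Submodule.smul_mem _ _ (hp.mem_DXdeg ha b))
  · exact Submodule.zero_mem _

/-- By duality D_b sees only the summand of b, which is present exactly when the cell lies in C(b).
-/
theorem solvesCellSystem_cellPolynomial {p : NB a → MvPolynomial (Fin s) ℝ}
    (hp : IsPolarFamily a p) (ha : ∀ i, a i ≠ 0) (c : Set (Fin s → ℝ)) :
    SolvesCellSystem a c (cellPolynomial a p c) := by
  classical
  have h (b : NB a) : DOp a (b.1)ᶜ (cellPolynomial a p c) =
      if c ⊆ cone a b.1 then C (absDet a b)⁻¹ else 0 := by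
    rw [cellPolynomial, map_sum, Finset.sum_eq_single b]
    · split_ifs
      · rw [map_smul, hp.DOp_reflect_eq ha, if_pos rfl, smul_eq_C_mul, mul_one]
      · rw [map_zero]
    · intro b' _ hb
      split_ifs
      · rw [map_smul, hp.DOp_reflect_eq ha, if_neg (Ne.symm hb), smul_zero]
      · rw [map_zero]
    · simp
  exact fun b => ⟨fun hb => by rw [h, if_pos hb], fun hb => by rw [h, if_neg hb]⟩

theorem IsMultivariateSpline.ae_eq {T T' : (Fin s → ℝ) → ℝ} (hT : IsMultivariateSpline a T)
    (hT' : IsMultivariateSpline a T') : T =ᵐ[volume] T' := by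
  refine ae_eq_of_integral_contDiff_smul_eq hT.1 hT'.1 fun g hg hg' => ?_
  simp only [smul_eq_mul]
  rw [hT.2 g hg.continuous hg', hT'.2 g hg.continuous hg']

theorem multivariateSpline_spec (hs : Submodule.span ℝ (Set.range a) = ⊤)
    (h0 : (0 : Fin s → ℝ) ∉ convexHull ℝ (Set.range a)) :
    (∃ T, IsMultivariateSpline a T ∧ ∀ c, IsBigCell a c → ContinuousOn T c) ∧
    ∀ c, IsBigCell a c → ∃ q : MvPolynomial (Fin s) ℝ,
      (q ∈ DXdeg a (N - s) ∧ SolvesCellSystem a c q) ∧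
      (∀ q' ∈ DXdeg a (N - s), SolvesCellSystem a c q' → q' = q) ∧
      ∀ T, IsMultivariateSpline a T →
        (∀ᵐ x ∂(volume.restrict c), T x = eval x q) ∧
        (ContinuousOn T c → ∀ x ∈ c, T x = eval x q) := by
  obtain ⟨y, hy⟩ := exists_pos_of_zero_notMem_convexHull h0
  have ha (i) : a i ≠ 0 := fun h => by simpa [h] using hy i
  obtain ⟨p, hp⟩ := exists_isPolarFamily ha hs
  have hT0 := isMultivariateSpline_piecewiseSpline hy hp
  refine ⟨⟨_, hT0, fun c hc => ?_⟩, fun c hc => ?_⟩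
  · exact (continuous_eval (cellPolynomial a p c)).continuousOn.congr
      fun x hx => hc.piecewiseSpline_eq p hx
  have hq := cellPolynomial_mem_DXdeg hp ha c
  have hq' := solvesCellSystem_cellPolynomial hp ha c
  refine ⟨_, ⟨hq, hq'⟩, fun q' h h' => eq_of_mem_DXdeg hs h hq fun b => ?_, fun T hT => ?_⟩
  · by_cases hb : c ⊆ cone a b.1
    · rw [(h' b).1 hb, (hq' b).1 hb]
    · rw [(h' b).2 hb, (hq' b).2 hb]
  have hco := hc.isOpen hy hs
  have h1 : ∀ᵐ x ∂(volume.restrict c), T x = eval x (cellPolynomial a p c) := by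
    filter_upwards [ae_restrict_of_ae (hT.ae_eq hT0), ae_restrict_mem hco.measurableSet] with x h2 hx
    rw [h2, hc.piecewiseSpline_eq p hx]
  -- Two continuous functions that agree almost everywhere on an open set agree everywhere on it.
  exact ⟨h1, fun hTc =>
    Measure.eqOn_open_of_ae_eq h1 hco hTc (continuous_eval _).continuousOn⟩

end BigCells

end Spline

theorem mainTheorem5 {K : Type*} [Field K] [CharZero K] :
    -- the polynomials `p_b`: existence, uniqueness, duality, independence, characterization
    (∀ (s N : ℕ) (a : Fin N → Fin s → K),
      (∀ i, a i ≠ 0) → Submodule.span K (Set.range a) = ⊤ →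
      (∃! p : Spline.NB a → MvPolynomial (Fin s) K, Spline.IsPolarFamily a p) ∧
      ∀ p : Spline.NB a → MvPolynomial (Fin s) K, Spline.IsPolarFamily a p →
        (∀ b, p b ∈ Spline.DXdeg a (N - s)) ∧
        (∀ b c : Spline.NB a,
          Spline.DOp a (b.1)ᶜ (Spline.reflect (p c)) = if b = c then 1 else 0) ∧
        LinearIndependent K p ∧
        (∀ c : Spline.NB a, ∀ q ∈ Spline.DXdeg a (N - s),
          (∀ b : Spline.NB a,
            Spline.DOp a (b.1)ᶜ (Spline.reflect q) = if b = c then 1 else 0) → q = p c)) ∧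
    -- the multivariate spline on the big cells
    (∀ (s N : ℕ) (a : Fin N → Fin s → ℝ),
      Submodule.span ℝ (Set.range a) = ⊤ → (0 : Fin s → ℝ) ∉ convexHull ℝ (Set.range a) →
      (∃ T : (Fin s → ℝ) → ℝ, Spline.IsMultivariateSpline a T ∧
        ∀ c, Spline.IsBigCell a c → ContinuousOn T c) ∧
      ∀ c : Set (Fin s → ℝ), Spline.IsBigCell a c →
        ∃ q : MvPolynomial (Fin s) ℝ,
          (q ∈ Spline.DXdeg a (N - s) ∧ Spline.SolvesCellSystem a c q) ∧
          (∀ q' ∈ Spline.DXdeg a (N - s), Spline.SolvesCellSystem a c q' → q' = q) ∧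
          ∀ T : (Fin s → ℝ) → ℝ, Spline.IsMultivariateSpline a T →
            (∀ᵐ x ∂(MeasureTheory.volume.restrict c), T x = MvPolynomial.eval x q) ∧
            (ContinuousOn T c → ∀ x ∈ c, T x = MvPolynomial.eval x q)) := by
  exact ⟨fun _ _ _ ha hs => Spline.polarFamily_spec ha hs,
    fun _ _ _ hs h0 => Spline.multivariateSpline_spec hs h0⟩
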